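/- **Setting.** Let $A\in\mathbb R^{n\times n}$, $B\in\mathbb R^{n\times m}$, $C\in\mathbb R^{p\times n}$, and let $K$, $L$ be such that $A+BK$ and $A-LC$ are Hurwitz. Let $D_1,D_2:\mathbb R\to(0,\infty)$ be continuous delays and $\phi_i(t)=t-D_i(t)$. Assume for $i=1,2$ that $\phi_i$ is $C^1$ on $(0,\infty)$; that there are constants $\pi_0^*,\pi_2^*>0$ with $t-\phi_i(t)\ge\pi_0^*$ and $\phi_i'(t)\ge\pi_2^*$ for all $t>0$; and that $\nu-\phi_i(\nu)$ and $\phi_i'(\nu)$ are bounded above on $\nu\ge\phi_i^{-1}(0)$. Let $\psi(t)=\phi_1^{-1}(t)-t$, $t\ge0$, be the exact prediction horizon. For a function $\hat\psi$ on $[0,\infty)$, a solution of the closed loop with horizon $\hat\psi$ is a triple $(Z,\xi,U)$ with $Z:[\phi_2(0),\infty)\to\mathbb R^n$ and $\xi:[0,\infty)\to\mathbb R^n$ continuous and $U$ an $\mathbb R^m$-valued, Borel measurable, locally bounded function of time, such that, in the integral sense, $$\dot Z(t)=AZ(t)+BU(\phi_1(t)),\qquad t\ge\phi_2(0),$$ $$\dot\xi(t)=\phi_2'(t)\bigl[A\xi(t)+BU(\phi_1(\phi_2(t)))+L\bigl(CZ(\phi_2(t))-C\xi(t)\bigr)\bigr],\qquad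 t\ge0,$$ and $U(t)=K\hat P(t)$ for $t>0$, where $$\hat Z(t)=e^{A(t-\phi_2(t))}\xi(t)+\int_{\phi_2(t)}^te^{A(t-\tau)}BU(\phi_1(\tau))\,d\tau,$$ $$\hat P(t)=e^{A\hat\psi(t)}\hat Z(t)+\int_0^1\hat\psi(t)\,e^{A(1-y)\hat\psi(t)}B\,u(y,t)\,dy,\qquad u(y,t)=U(\phi_1(t+y\psi(t)));$$ at times $t$ with $\hat\psi(t)\le\psi(t)$ the predictor may alternatively be $$\hat P(t)=e^{A\hat\psi(t)}\hat Z(t)+\int_t^{t+\hat\psi(t)}e^{A(t+\hat\psi(t)-s)}BU(\phi_1(s))\,ds.$$ (The two forms coincide for $\hat\psi=\psi$.) The values of $U$ up to time $0$, $Z(\phi_2(0))$ and $\xi(0)$ are free initial data. Put $$\Gamma(t)=|Z(t)|^2+|Z(t)-\hat Z(t)|^2+\sup_{\phi_1(t)\le\tau\le t}|U(\tau)|^2 .$$ **Constants.** Call $(\epsilon^*,M,C(\cdot))$ *stability constants* of the system if $\epsilon^*>0$, $M>0$, $C$ is a positive, decreasing (not necessarily strictly) function on $(0,\epsilon^*]$,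 and for every $\epsilon\in(0,\epsilon^*)$ and every $\hat\psi$ with $|\psi(t)-\hat\psi(t)|\le\epsilon$ for all $t\ge0$, all closed-loop solutions satisfy $\Gamma(t)\le Me^{-C(\epsilon)t}\,\Gamma(0)$ for all $t\ge0$. **Claim.** Stability constants exist, even with $C$ strictly decreasing. Moreover, for any stability constants $(\epsilon^*,M,C(\cdot))$, any $\epsilon\in(0,\epsilon^*)$ and any window length $H>0$ with $H>\ln(M)/C(\epsilon^*)$: 1. for every $t\ge0$ there is an approximation $\hat\psi_t$, continuous on $[t,t+H]$, with $|\psi(\tau)-\hat\psi_t(\tau)|\le\epsilon$ for $\tau\in[t,t+H]$; 2. $\bar C:=C(\epsilon)-\ln(M)/H>0$; 3. if the approximation is recomputed on the successive windows $[kH,(k+1)H]$, $k=0,1,2,\dots$, that is, the closed loop uses $\hat\psi(t)=\hat\psi_k(t)$ for $t\in[kH,(k+1)H)$, where $|\psi(\tau)-\hat\psi_k(\tau)|\le\epsilon$ for all $\tau\in[kH,(k+1)H]$ and every $k$, then all closed-loop solutions satisfy $$\Gamma(t)\le M e^{-\bar C t}\,\Gamma(0)\qquad\text{for all }t\ge0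 .$$ -/

import Mathlib

open Set MeasureTheory

noncomputable section

/-- `ℝᵈ` with the Euclidean norm. -/
abbrev Vec (d : ℕ) : Type := EuclideanSpace ℝ (Fin d)

/-- Matrix times vector, on Euclidean spaces. -/
abbrev mulE {a b : ℕ} (M : Matrix (Fin a) (Fin b) ℝ) (x : Vec b) : Vec a :=
  Matrix.toEuclideanLin M x

/-- A real square matrix is Hurwitz if all its complex eigenvalues have negative real part. -/
def IsHurwitz {d : ℕ} (M : Matrix (Fin d) (Fin d) ℝ) : Prop :=
  ∀ z ∈ spectrum ℂ (M.map (algebraMap ℝ ℂ)), z.re < 0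

/-- The data: plant matrices `A`, `B`, `C`, feedback and observer gains `K`, `L`, and the
input and measurement delays `D₁`, `D₂`. -/
structure DelaySystem (n m p : ℕ) where
  A : Matrix (Fin n) (Fin n) ℝ
  B : Matrix (Fin n) (Fin m) ℝ
  C : Matrix (Fin p) (Fin n) ℝ
  K : Matrix (Fin m) (Fin n) ℝ
  L : Matrix (Fin n) (Fin p) ℝ
  D₁ : ℝ → ℝ
  D₂ : ℝ → ℝ

/-- The delayed time `φ(t) = t - D(t)`. -/
def delayedTime (D : ℝ → ℝ) (t : ℝ) : ℝ := t - D t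

/-- The inverse `φ⁻¹` of `φ : [0, ∞) → ℝ`. -/
def delayedTimeInv (D : ℝ → ℝ) (y : ℝ) : ℝ :=
  Function.invFunOn (delayedTime D) (Ici 0) y

/-- The assumptions on one delay: `D` is positive and continuous, `φ(t) = t - D(t)` is `C¹` for
`t > 0`, `D ≥ π₀ > 0` and `φ' ≥ π₂ > 0` for `t > 0`, and the suprema of `D = ν - φ(ν)` and of
`φ'` over `ν ≥ φ⁻¹(0)` are finite (their reciprocals are positive numbers). -/
structure AdmissibleDelay (D : ℝ → ℝ) : Prop where
  pos : ∀ t, 0 < D t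
  cont : Continuous D
  contDiff : ContDiffOn ℝ 1 (delayedTime D) (Ioi 0)
  lower : ∃ π₀ > 0, ∀ t > 0, π₀ ≤ t - delayedTime D t
  bdd : BddAbove ((fun ν => ν - delayedTime D ν) '' Ici (delayedTimeInv D 0))
  deriv_lower : ∃ π₂ > 0, ∀ t > 0, π₂ ≤ deriv (delayedTime D) t
  deriv_bdd : BddAbove (deriv (delayedTime D) '' Ici (delayedTimeInv D 0))

/-- `φ⁻¹` really is the inverse of `φ` on `[φ(0), ∞)`, in particular on `[0, ∞)`. -/
theorem AdmissibleDelay.inv_spec {D : ℝ → ℝ} (h : AdmissibleDelay D) {y : ℝ}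
    (hy : delayedTime D 0 ≤ y) :
    0 ≤ delayedTimeInv D y ∧ delayedTime D (delayedTimeInv D y) = y := by
  obtain ⟨c, hc, hd⟩ := h.deriv_lower
  have hcont : Continuous (delayedTime D) := continuous_id.sub h.cont
  have hgrow : ∀ t, 0 ≤ t → c * (t - 0) ≤ delayedTime D t - delayedTime D 0 := by
    intro t ht
    refine (convex_Ici (0 : ℝ)).mul_sub_le_image_sub_of_le_deriv hcont.continuousOn ?_ ?_
      0 self_mem_Ici t ht ht
    · rw [interior_Ici]
      exact h.contDiff.differentiableOn (by norm_num)
    · rw [interior_Ici]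
      exact fun x hx => hd x hx
  set T := (y - delayedTime D 0) / c with hT
  have hT0 : 0 ≤ T := div_nonneg (by linarith) hc.le
  have h1 := hgrow T hT0
  have h2 : c * T = y - delayedTime D 0 := by rw [hT]; field_simp
  have hmem : ∃ a ∈ Ici (0 : ℝ), delayedTime D a = y := by
    obtain ⟨a, ha, hay⟩ := intermediate_value_Icc hT0 hcont.continuousOn
      (show y ∈ Icc (delayedTime D 0) (delayedTime D T) from ⟨hy, by linarith⟩)
    exact ⟨a, ha.1, hay⟩
  exact ⟨Function.invFunOn_mem hmem, Function.invFunOn_eq hmem⟩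

namespace DelaySystem

variable {n m p : ℕ} (S : DelaySystem n m p)

/-- Both delays are admissible, and `A + BK`, `A - LC` are Hurwitz. -/
structure Admissible : Prop where
  delay₁ : AdmissibleDelay S.D₁
  delay₂ : AdmissibleDelay S.D₂
  hurwitz_feedback : IsHurwitz (S.A + S.B * S.K)
  hurwitz_observer : IsHurwitz (S.A - S.L * S.C)

/-- `φ₁(t) = t - D₁(t)`. -/
def φ₁ (t : ℝ) : ℝ := delayedTime S.D₁ t

/-- `φ₂(t) = t - D₂(t)`. -/
def φ₂ (t : ℝ) : ℝ := delayedTime S.D₂ t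

/-- The exact prediction horizon `ψ(t) = φ₁⁻¹(t) - t`. -/
def ψ (t : ℝ) : ℝ := delayedTimeInv S.D₁ t - t

/-- The flow `e^{A r}` applied to a vector. -/
def flow (r : ℝ) (x : Vec n) : Vec n := mulE (NormedSpace.exp (r • S.A)) x

/-- The reconstructed current state
`Ẑ(t) = e^{A(t - φ₂(t))} ξ(t) + ∫_{φ₂(t)}^t e^{A(t-τ)} B U(φ₁(τ)) dτ`. -/
def zHat (ξ : ℝ → Vec n) (U : ℝ → Vec m) (t : ℝ) : Vec n :=
  S.flow (t - S.φ₂ t) (ξ t) +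
    ∫ τ in (S.φ₂ t)..t, S.flow (t - τ) (mulE S.B (U (S.φ₁ τ)))

/-- The predictor with horizon `h` at time `t`, in original time:
`e^{Ah} Ẑ(t) + ∫_t^{t+h} e^{A(t+h-s)} B U(φ₁(s)) ds`.
It uses only inputs up to time `t` if and only if `φ₁(t + h) ≤ t`, that is, `h ≤ ψ(t)`. -/
def predictorDirect (h : ℝ) (ξ : ℝ → Vec n) (U : ℝ → Vec m) (t : ℝ) : Vec n :=
  S.flow h (S.zHat ξ U t) +
    ∫ s in t..(t + h), S.flow (t + h - s) (mulE S.B (U (S.φ₁ s)))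

/-- The distributed input (state of the transport equation) `u(x,t) = U(φ₁(t + x ψ(t)))`,
`0 ≤ x ≤ 1`: the inputs on `[φ₁(t), t]` that have not yet reached the plant. -/
def distInput (U : ℝ → Vec m) (x t : ℝ) : Vec m := U (S.φ₁ (t + x * S.ψ t))

/-- The predictor with horizon `h` at time `t`, in terms of the distributed input:
`e^{Ah} Ẑ(t) + ∫_0^1 h e^{A(1-y)h} B u(y,t) dy`. It is causal for every `h`. -/
def predictorTransport (h : ℝ) (ξ : ℝ → Vec n) (U : ℝ → Vec m) (t : ℝ) : Vec n :=
  S.flow h (S.zHat ξ U t) +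
    ∫ y in (0 : ℝ)..1, h • S.flow ((1 - y) * h) (mulE S.B (S.distInput U y t))

/-- For the exact horizon `h = ψ(t)` the two forms of the predictor agree. -/
theorem predictorTransport_exact (ξ : ℝ → Vec n) (U : ℝ → Vec m) (t : ℝ) :
    S.predictorTransport (S.ψ t) ξ U t = S.predictorDirect (S.ψ t) ξ U t := by
  unfold predictorTransport predictorDirect distInput
  congr 1
  have key := intervalIntegral.smul_integral_comp_add_mul
    (f := fun s => S.flow (t + S.ψ t - s) (mulE S.B (U (S.φ₁ s)))) (a := 0) (b := 1) (S.ψ t) t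
  rw [intervalIntegral.integral_smul]
  simp only [mul_zero, add_zero, mul_one] at key
  rw [← key]
  congr 1
  refine intervalIntegral.integral_congr fun y _ => ?_
  rw [show t + S.ψ t - (t + S.ψ t * y) = (1 - y) * S.ψ t by ring, mul_comm y]

/-- `(Z, ξ, U)` is a solution of the closed loop in which the approximate horizon `ψh` is used.

`U` is Borel measurable and bounded on bounded intervals. The differential equations are
understood in integral (Carathéodory) form, since `U` may jump. The plant equation
`Ż = A Z + B U(φ₁)` holds from time `φ₂(0)` on, where the first measured state lies; `ξ(0)`, the
state `Z(φ₂(0))` and the inputs up to time `0` are free initial data. -/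
structure IsClosedLoop (ψh : ℝ → ℝ) (Z ξ : ℝ → Vec n) (U : ℝ → Vec m) : Prop where
  meas_U : Measurable U
  bdd_U : ∀ a b : ℝ, BddAbove ((fun τ => ‖U τ‖) '' Icc a b)
  cont_Z : ContinuousOn Z (Ici (S.φ₂ 0))
  cont_ξ : ContinuousOn ξ (Ici 0)
  plant : ∀ t ≥ S.φ₂ 0,
    Z t = Z (S.φ₂ 0) + ∫ s in (S.φ₂ 0)..t, (mulE S.A (Z s) + mulE S.B (U (S.φ₁ s)))
  observer : ∀ t ≥ 0,
    ξ t = ξ 0 + ∫ s in (0 : ℝ)..t, deriv S.φ₂ s •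
      (mulE S.A (ξ s) + mulE S.B (U (S.φ₁ (S.φ₂ s))) +
        mulE S.L (mulE S.C (Z (S.φ₂ s)) - mulE S.C (ξ s)))
  feedback : ∀ t > 0,
    U t = mulE S.K (S.predictorTransport (ψh t) ξ U t) ∨
      (ψh t ≤ S.ψ t ∧ U t = mulE S.K (S.predictorDirect (ψh t) ξ U t))

/-- `Γ(t) = |Z(t)|² + |Z(t) - Ẑ(t)|² + sup_{φ₁(t) ≤ τ ≤ t} |U(τ)|²`. -/
def Γ (Z ξ : ℝ → Vec n) (U : ℝ → Vec m) (t : ℝ) : ℝ :=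
  ‖Z t‖ ^ 2 + ‖Z t - S.zHat ξ U t‖ ^ 2 + sSup ((fun τ => ‖U τ‖ ^ 2) '' Icc (S.φ₁ t) t)

/-- `ε*`, `M` and the function `ε ↦ C(ε)` are robust stability constants of the system:
`C` is positive and decreasing on `(0, ε*]`, and `Γ(t) ≤ M e^{-C(ε)t} Γ(0)` along all solutions
of the closed loop with any approximation that is within `ε < ε*` of `ψ` for all time. -/
structure IsStabilityConstants (εs M : ℝ) (Cf : ℝ → ℝ) : Prop where
  eps_pos : 0 < εs
  M_pos : 0 < M
  rate_pos : ∀ ε ∈ Ioc 0 εs, 0 < Cf ε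
  rate_anti : AntitoneOn Cf (Ioc 0 εs)
  bound : ∀ ε ∈ Ioo 0 εs, ∀ ψh : ℝ → ℝ, (∀ t ≥ 0, |S.ψ t - ψh t| ≤ ε) →
    ∀ (Z ξ : ℝ → Vec n) (U : ℝ → Vec m), S.IsClosedLoop ψh Z ξ U →
      ∀ t ≥ 0, S.Γ Z ξ U t ≤ M * Real.exp (-Cf ε * t) * S.Γ Z ξ U 0

/-- The horizon used when the approximation is recomputed on the successive windows
`[kH, (k+1)H]`, the `k`-th approximation being `ψw k`. -/
def windowed (H : ℝ) (ψw : ℕ → ℝ → ℝ) (t : ℝ) : ℝ := ψw ⌊t / H⌋₊ t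

end DelaySystem

end

/-! ### Exponential flows in Banach algebras. -/

section ExpFlow

open NormedSpace

variable {𝔸 : Type*} [NormedRing 𝔸] [NormedAlgebra ℝ 𝔸] [CompleteSpace 𝔸]

/-! Stability constants come from a small-gain argument in exponentially weighted sup norms. In the
time scale `φ₂` the observer error solves the autonomous equation of `A - LC`, so `Z - Ẑ` decays
whatever the input and the horizon (`observer_error`, `exists_reconstruction_decay`). With the exact
horizon the predictor misses `Z(φ₁⁻¹(t))` only by the flow of this error; a horizon error `ε` adds
at most a multiple of `ε` times the size of state and input (`exists_predictor_error`). Hence the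
input reaching the plant at time `s` is `K Z(s)` plus a perturbation, and since `A + BK` is Hurwitz,
a decaying perturbation produces a decaying state (`exists_state_decay`).

For small `ε`, an envelope `N e^{-μt}` for state and input on a finite horizon therefore improves to
`(αG + N/2) e^{-μt}`, where `G` measures the initial data (`exists_envelope_contraction`). The
smallest such `N` is finite because solutions are locally bounded, so `N ≤ 2αG` with constants
independent of the horizon (`exists_Γ_decay`).

The windowed claim needs no restarting of estimates: the concatenated horizon is itself within `ε`
of `ψ` at all times, so the stability bound applies once, with rate `C(ε)`. Subtracting `ln(M)/H`
only weakens it if `M ≥ 1`; if `M < 1`, the bound at time `0` forces `Γ(0) = 0` (`bound_sub_log`).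
-/

theorem exp_add_smul_eq_mul (a : 𝔸) (r s : ℝ) :
    exp ((r + s) • a) = exp (r • a) * exp (s • a) := by
  let +nondep : NormedAlgebra ℚ 𝔸 := .restrictScalars ℚ ℝ 𝔸
  rw [add_smul]
  exact exp_add_of_commute (((Commute.refl a).smul_left r).smul_right s)

theorem exp_neg_smul_mul_exp_smul (a : 𝔸) (r : ℝ) : exp ((-r) • a) * exp (r • a) = 1 := by
  rw [← exp_add_smul_eq_mul, neg_add_cancel, zero_smul, exp_zero]

theorem continuous_exp_smul (a : 𝔸) : Continuous fun r : ℝ => exp (r • a) :=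
  continuous_iff_continuousAt.2 fun r => (hasDerivAt_exp_smul_const a r).continuousAt

/-- On a bounded range of times the exponential flow is bounded and Lipschitz. -/
theorem exists_exp_smul_bound (a : 𝔸) (R : ℝ) :
    ∃ c, 1 ≤ c ∧ (∀ r ∈ Icc (-R) R, ‖exp (r • a)‖ ≤ c) ∧
      ∀ r ∈ Icc (-R) R, ∀ s ∈ Icc (-R) R, ‖exp (r • a) - exp (s • a)‖ ≤ c * |r - s| := by
  obtain ⟨c, hc⟩ := (isCompact_Icc (a := -R) (b := R)).exists_bound_of_continuousOn
    (continuous_exp_smul a).continuousOn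
  refine ⟨max 1 (max c (c * ‖a‖)), le_max_left _ _,
    fun r hr => (hc r hr).trans ((le_max_left _ _).trans (le_max_right _ _)), fun r hr s hs => ?_⟩
  have h := (convex_Icc (-R) R).norm_image_sub_le_of_norm_hasDerivWithin_le
    (f := fun r : ℝ => exp (r • a)) (C := c * ‖a‖)
    (fun x _ => (hasDerivAt_exp_smul_const a x).hasDerivWithinAt)
    (fun x hx => (norm_mul_le _ _).trans (by gcongr; exact hc x hx)) hs hr
  refine h.trans ?_
  rw [Real.norm_eq_abs]
  gcongr
  exact (le_max_right _ _).trans (le_max_right _ _)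

/-- If some power of `exp a` is a contraction, then the flow of `a` decays exponentially. -/
theorem exists_exp_smul_decay_of_pow (a : 𝔸) {N : ℕ} (hN : 0 < N) (h : ‖exp a ^ N‖ < 1) :
    ∃ c > 0, ∃ l > 0, ∀ t : ℝ, 0 ≤ t → ‖exp (t • a)‖ ≤ c * Real.exp (-l * t) := by
  let +nondep : NormedAlgebra ℚ 𝔸 := .restrictScalars ℚ ℝ 𝔸
  have hN' : (0 : ℝ) < N := by exact_mod_cast hN
  obtain ⟨c, hc1, hc, -⟩ := exists_exp_smul_bound a N
  -- The lower cutoff `1/2` keeps `q` positive, so that `log q` gives a genuine rate.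
  set q : ℝ := max ‖exp a ^ N‖ (1 / 2) with hq
  have hq0 : 0 < q := lt_max_of_lt_right (by norm_num)
  have hq1 : q < 1 := max_lt h (by norm_num)
  have hlog : Real.log q < 0 := Real.log_neg hq0 hq1
  have step : ∀ (k : ℕ) (r : ℝ), r ∈ Icc (0 : ℝ) N → ‖exp ((k * N + r) • a)‖ ≤ q ^ k * c := by
    intro k r hr
    induction k with
    | zero => simpa using hc r ⟨by linarith [hr.1], hr.2⟩
    | succ k ih =>
      have : ((k + 1 : ℕ) * N + r : ℝ) = N + (k * N + r) := by push_cast; ring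
      rw [this, exp_add_smul_eq_mul]
      have hp : exp ((N : ℝ) • a) = exp a ^ N := by
        rw [← exp_nsmul, Nat.cast_smul_eq_nsmul]
      rw [hp, pow_succ', mul_assoc]
      exact (norm_mul_le _ _).trans (mul_le_mul (le_max_left _ _) ih (norm_nonneg _) hq0.le)
  -- The factor `exp (-log q) = 1/q` pays for the incomplete last period: `q ^ k ≤ q ^ (t/N - 1)`
  -- for `k = ⌊t/N⌋`.
  refine ⟨c * Real.exp (-Real.log q), by positivity, -Real.log q / N, by
    apply div_pos _ hN'; linarith, fun t ht => ?_⟩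
  set k := ⌊t / N⌋₊ with hk
  have h1 : (k : ℝ) ≤ t / N := Nat.floor_le (by positivity)
  have h2 : t / N < k + 1 := Nat.lt_floor_add_one _
  have h1' : k * N ≤ t := by rwa [le_div_iff₀ hN'] at h1
  have h2' : t < (k + 1) * N := by rwa [div_lt_iff₀ hN'] at h2
  have h3 := step k (t - k * N) ⟨by linarith, by nlinarith⟩
  rw [add_sub_cancel] at h3
  refine h3.trans ?_
  rw [mul_comm, mul_assoc, ← Real.exp_add]
  gcongr
  rw [← Real.exp_log hq0, ← Real.exp_nat_mul, Real.log_exp]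
  apply Real.exp_le_exp.2
  have : -(-Real.log q / N) * t = Real.log q * (t / N) := by ring
  rw [this]
  nlinarith

/-- Gelfand's formula: a spectral radius below one makes some power of `exp a` a strict contraction.
-/
theorem exists_exp_smul_decay_of_spectrum {𝔸 : Type*} [NormedRing 𝔸] [NormedAlgebra ℂ 𝔸]
    [CompleteSpace 𝔸] (a : 𝔸) (h : ∀ z ∈ spectrum ℂ (exp a), ‖z‖ < 1) :
    ∃ c > 0, ∃ l > 0, ∀ t : ℝ, 0 ≤ t → ‖exp ((t : ℂ) • a)‖ ≤ c * Real.exp (-l * t) := by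
  let _ : NormedAlgebra ℝ 𝔸 := .restrictScalars ℝ ℂ 𝔸
  have key : ∃ N : ℕ, 0 < N ∧ ‖exp a ^ N‖ < 1 := by
    rcases subsingleton_or_nontrivial 𝔸 with _ | _
    · exact ⟨1, one_pos, by simp [Subsingleton.elim (exp a ^ 1) 0]⟩
    have h1 : spectralRadius ℂ (exp a) < (1 : NNReal) :=
      spectrum.spectralRadius_lt_of_forall_lt _ fun z hz => by
        rw [← NNReal.coe_lt_coe]; exact h z hz
    have h2 := spectrum.pow_nnnorm_pow_one_div_tendsto_nhds_spectralRadius (exp a)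
    obtain ⟨N, hN, hN0⟩ := ((h2.eventually_lt_const h1).and
      (Filter.eventually_gt_atTop 0)).exists
    refine ⟨N, hN0, ?_⟩
    by_contra! hcon
    have : (1 : ENNReal) ≤ (‖exp a ^ N‖₊ : ENNReal) ^ (1 / N : ℝ) := by
      apply ENNReal.one_le_rpow
      · exact_mod_cast hcon
      · have : (0 : ℝ) < N := by exact_mod_cast hN0
        positivity
    exact absurd hN (by simpa using this)
  obtain ⟨N, hN, hlt⟩ := key
  obtain ⟨c, hc, l, hl, hb⟩ := exists_exp_smul_decay_of_pow a hN hlt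
  refine ⟨c, hc, l, hl, fun t ht => ?_⟩
  have : (t : ℂ) • a = t • a := rfl
  rw [this]; exact hb t ht

end ExpFlow

/-! ### Decay of the flow of a Hurwitz matrix. -/

section Hurwitz

open NormedSpace

-- For the L2 operator norm the passage from matrices to operators is an isometric algebra map,
-- hence continuous, hence compatible with the exponential series.
open scoped Matrix.Norms.L2Operator in
theorem toEuclideanCLM_exp_smul {d : ℕ} (M : Matrix (Fin d) (Fin d) ℝ) (r : ℝ) :
    Matrix.toEuclideanCLM (𝕜 := ℝ) (exp (r • M)) =
      exp (r • Matrix.toEuclideanCLM (𝕜 := ℝ) M) := by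
  let +nondep : NormedAlgebra ℚ (Matrix (Fin d) (Fin d) ℝ) := .restrictScalars ℚ ℝ _
  rw [map_exp (Matrix.toEuclideanCLM (n := Fin d) (𝕜 := ℝ))
    (AddMonoidHomClass.isometry_of_norm _ fun A => Matrix.l2_opNorm_toEuclideanCLM A).continuous,
    map_smul]

open scoped Matrix.Norms.L2Operator Matrix

/-- Every eigenvalue of the exponential of a complex matrix is the exponential of an eigenvalue. -/
theorem exists_mem_spectrum_exp_eq {d : ℕ} (M : Matrix (Fin d) (Fin d) ℂ) {z : ℂ}
    (hz : z ∈ spectrum ℂ (exp M)) : ∃ w ∈ spectrum ℂ M, Complex.exp w = z := by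
  have hcomm : Commute (exp M).toLin' M.toLin' := by
    have := ((Commute.refl M).exp_left)
    change _ * _ = _ * _
    rw [Module.End.mul_eq_comp, Module.End.mul_eq_comp, ← Matrix.toLin'_mul, ← Matrix.toLin'_mul,
      this.eq]
  rw [← Matrix.spectrum_toLin', ← Module.End.hasEigenvalue_iff_mem_spectrum] at hz
  -- Since `M` commutes with `exp M`, it acts on this eigenspace and has an eigenvector there; the
  -- exponential series on that vector identifies `z`.
  have hmaps : MapsTo M.toLin' (Module.End.eigenspace (exp M).toLin' z) (Module.End.eigenspace (exp M).toLin' z) :=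
    Module.End.mapsTo_genEigenspace_of_comm hcomm z 1
  have : Nontrivial (Module.End.eigenspace (exp M).toLin' z) := Submodule.nontrivial_iff_ne_bot.2 hz
  obtain ⟨w, hw⟩ := Module.End.exists_eigenvalue (M.toLin'.restrict hmaps)
  obtain ⟨⟨v, hv⟩, hv1⟩ := hw.exists_hasEigenvector
  have hv0 : v ≠ 0 := fun h => hv1.2 (Subtype.ext h)
  have hMv : M.toLin' v = w • v := congrArg Subtype.val hv1.apply_eq_smul
  have hEv : (exp M).toLin' v = z • v := Module.End.mem_eigenspace_iff.1 hv
  refine ⟨w, ?_, ?_⟩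
  · rw [← Matrix.spectrum_toLin', ← Module.End.hasEigenvalue_iff_mem_spectrum]
    exact Module.End.hasEigenvalue_of_hasEigenvector
      (Module.End.hasEigenvector_iff.2 ⟨Module.End.mem_eigenspace_iff.2 hMv, hv0⟩)
  · have hpow : ∀ k : ℕ, (M ^ k).toLin' v = w ^ k • v := by
      intro k
      induction k with
      | zero => simp
      | succ k ih =>
        rw [pow_succ', Matrix.toLin'_mul, LinearMap.comp_apply, ih, map_smul, hMv, smul_smul,
          pow_succ]
    have h1 := exp_series_hasSum_exp' (𝕂 := ℂ) M
    let ev : Matrix (Fin d) (Fin d) ℂ →ₗ[ℂ] (Fin d → ℂ) :=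
      (LinearMap.applyₗ v).comp (Matrix.toLin' (R := ℂ) (m := Fin d) (n := Fin d)).toLinearMap
    have h2 := h1.map ev ev.continuous_of_finiteDimensional
    have h3 := (exp_series_hasSum_exp' (𝕂 := ℂ) w).smul_const v
    have h4 : (ev ∘ fun k : ℕ => ((k.factorial : ℂ)⁻¹) • M ^ k) =
        fun k : ℕ => ((k.factorial : ℂ)⁻¹ • w ^ k) • v := by
      ext1 k
      change (((k.factorial : ℂ)⁻¹ • M ^ k).toLin') v = _
      rw [map_smul, LinearMap.smul_apply, hpow, smul_assoc]
    rw [h4] at h2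
    have h5 : z • v = exp w • v := hEv.symm.trans (h2.unique h3)
    rw [Complex.exp_eq_exp_ℂ]
    exact (smul_left_injective ℂ hv0 h5).symm

/-- The flow of a Hurwitz matrix decays exponentially. -/
theorem IsHurwitz.exists_exp_decay {d : ℕ} {M : Matrix (Fin d) (Fin d) ℝ} (h : IsHurwitz M) :
    ∃ c > 0, ∃ l > 0, ∀ t : ℝ, 0 ≤ t →
      ‖exp (t • Matrix.toEuclideanCLM (𝕜 := ℝ) M)‖ ≤ c * Real.exp (-l * t) := by
  obtain ⟨c, hc, l, hl, hb⟩ := exists_exp_smul_decay_of_spectrum (M.map (algebraMap ℝ ℂ))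
    (fun z hz => by
      obtain ⟨w, hw, rfl⟩ := exists_mem_spectrum_exp_eq _ hz
      rw [Complex.norm_exp, Real.exp_lt_one_iff]
      exact h w hw)
  refine ⟨c, hc, l, hl, fun t ht => ?_⟩
  refine le_trans ?_ (hb t ht)
  let +nondep : NormedAlgebra ℚ (Matrix (Fin d) (Fin d) ℝ) := .restrictScalars ℚ ℝ _
  have hC : exp ((t : ℂ) • M.map (algebraMap ℝ ℂ)) = (exp (t • M)).map (algebraMap ℝ ℂ) := by
    have := map_exp (algebraMap ℝ ℂ).mapMatrix
      (Continuous.matrix_map continuous_id Complex.continuous_ofReal) (t • M)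
    rw [RingHom.mapMatrix_apply, RingHom.mapMatrix_apply] at this
    rw [this]
    congr 1
    ext i j
    simp
  rw [← toEuclideanCLM_exp_smul, hC]
  -- The complexified matrix, tested on real vectors only, dominates the real operator norm.
  refine ContinuousLinearMap.opNorm_le_bound _ (norm_nonneg _) fun x => ?_
  set Q := exp (t • M)
  have h1 := Matrix.l2_opNorm_mulVec (Q.map (algebraMap ℝ ℂ))
    (WithLp.toLp 2 fun i => (x i : ℂ))
  convert h1 using 1
  · rw [EuclideanSpace.norm_eq, EuclideanSpace.norm_eq]
    congr 1
    refine Finset.sum_congr rfl fun i _ => ?_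
    have : ((EuclideanSpace.equiv (Fin d) ℂ).symm
        (Q.map (algebraMap ℝ ℂ) *ᵥ fun i => (x i : ℂ))) i =
        ((Matrix.toEuclideanCLM (𝕜 := ℝ) Q x) i : ℂ) := by
      simp [Matrix.mulVec, dotProduct]
    rw [this, Complex.norm_real]
  · rw [EuclideanSpace.norm_eq, EuclideanSpace.norm_eq]
    simp

end Hurwitz

/-! ### Variation of constants for measurable forcing. -/

section VariationOfConstants

open NormedSpace

variable {E : Type*} [NormedAddCommGroup E] [NormedSpace ℝ E]

theorem lipschitzOnWith_integral_of_bound {h : ℝ → E} {a b C : ℝ}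
    (hi : IntervalIntegrable h volume a b) (hC : ∀ s ∈ Icc a b, ‖h s‖ ≤ C) :
    LipschitzOnWith C.toNNReal (fun t => ∫ s in a..t, h s) (Icc a b) := by
  refine LipschitzOnWith.of_dist_le_mul fun x hx y hy => ?_
  have hab : a ≤ b := hx.1.trans hx.2
  have hsub : ∀ z ∈ Icc a b, IntervalIntegrable h volume a z := fun z hz =>
    hi.mono_set (by rw [uIcc_of_le hab, uIcc_of_le hz.1]; exact Icc_subset_Icc_right hz.2)
  rw [dist_eq_norm, intervalIntegral.integral_interval_sub_left (hsub x hx) (hsub y hy)]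
  have hC0 : 0 ≤ C := (norm_nonneg _).trans (hC x hx)
  rw [Real.coe_toNNReal _ hC0, Real.dist_eq]
  refine intervalIntegral.norm_integral_le_of_norm_le_const fun s hs => hC s ?_
  have := uIoc_subset_uIcc hs
  exact (uIcc_subset_Icc hy hx) this

theorem intervalIntegrable_clm_apply {F : Type*} [NormedAddCommGroup F] [NormedSpace ℝ F]
    {Φ : ℝ → E →L[ℝ] F} (hΦ : Continuous Φ) {g : ℝ → E} {a b : ℝ}
    (hg : IntervalIntegrable g volume a b) :
    IntervalIntegrable (fun s => Φ s (g s)) volume a b := by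
  rw [intervalIntegrable_iff] at hg ⊢
  obtain ⟨c, hc⟩ := (isCompact_uIcc (a := a) (b := b)).exists_bound_of_continuousOn
    hΦ.continuousOn
  refine Integrable.mono' (hg.norm.const_mul c) ?_ ?_
  · exact (ContinuousLinearMap.id ℝ (E →L[ℝ] F)).aestronglyMeasurable_comp₂
      hΦ.aestronglyMeasurable hg.aestronglyMeasurable
  · refine (ae_restrict_iff' measurableSet_uIoc).2 (Filter.Eventually.of_forall fun s hs => ?_)
    exact ((Φ s).le_opNorm _).trans
      (mul_le_mul_of_nonneg_right (hc s (uIoc_subset_uIcc hs)) (norm_nonneg _))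

/-- Variation of constants for the integral form of `Ż = T Z + g` with bounded forcing `g`. -/
theorem variation_of_constants [CompleteSpace E] (T : E →L[ℝ] E) {g Z : ℝ → E} {a b G : ℝ}
    (hab : a ≤ b) (hZ : ContinuousOn Z (Icc a b)) (hg : IntegrableOn g (Icc a b))
    (hG : ∀ s ∈ Icc a b, ‖g s‖ ≤ G)
    (heq : ∀ t ∈ Icc a b, Z t = Z a + ∫ s in a..t, (T (Z s) + g s)) :
    Z b = exp ((b - a) • T) (Z a) + ∫ s in a..b, exp ((b - s) • T) (g s) := by
  set Φ : ℝ → E →L[ℝ] E := fun s => exp ((b - s) • T) with hΦ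
  have hΦc : Continuous Φ := (continuous_exp_smul T).comp (continuous_const.sub continuous_id)
  have hΦd : ∀ s, HasDerivAt Φ (-(Φ s * T)) s := fun s => by
    have := (hasDerivAt_exp_smul_const T (b - s)).scomp s ((hasDerivAt_id s).const_sub b)
    exact this.congr_deriv (by simp [Φ])
  obtain ⟨cZ, hcZ⟩ := isCompact_Icc.exists_bound_of_continuousOn hZ
  obtain ⟨cΦ, hcΦ⟩ := (isCompact_Icc (a := a) (b := b)).exists_bound_of_continuousOn
    hΦc.continuousOn
  have hmem : a ∈ Icc a b := left_mem_Icc.2 hab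
  have hcΦ0 : 0 ≤ cΦ := (norm_nonneg _).trans (hcΦ a hmem)
  have hG0 : 0 ≤ G := (norm_nonneg _).trans (hG a hmem)
  have hcZ0 : 0 ≤ cZ := (norm_nonneg _).trans (hcZ a hmem)
  set h : ℝ → E := fun s => T (Z s) + g s with hh
  have hgi : IntervalIntegrable g volume a b :=
    (intervalIntegrable_iff_integrableOn_Icc_of_le hab).2 hg
  have hhi : IntervalIntegrable h volume a b := by
    refine IntervalIntegrable.add ?_ hgi
    refine (T.continuous.comp_continuousOn hZ).intervalIntegrable_of_Icc hab
  have hhb : ∀ s ∈ Icc a b, ‖h s‖ ≤ ‖T‖ * cZ + G := fun s hs =>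
    (norm_add_le _ _).trans (add_le_add ((T.le_opNorm _).trans (by gcongr; exact hcZ s hs)) (hG s hs))
  set k : ℝ → E := fun s => Φ s (g s) with hk
  have hki : IntervalIntegrable k volume a b := intervalIntegrable_clm_apply hΦc hgi
  have hkb : ∀ s ∈ Icc a b, ‖k s‖ ≤ cΦ * G := fun s hs =>
    ((Φ s).le_opNorm _).trans (mul_le_mul (hcΦ s hs) (hG s hs) (norm_nonneg _) hcΦ0)
  -- As `g` is merely integrable and bounded, `Z` is differentiable only almost everywhere. But `f`
  -- is Lipschitz, hence absolutely continuous, and its derivative vanishes almost everywhere, so it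
  -- is constant; its values at `a` and `b` give the formula.
  set f : ℝ → E := (fun s => Φ s (Z s)) - fun s => ∫ r in a..s, k r with hf
  have hZlip : LipschitzOnWith (‖T‖ * cZ + G).toNNReal Z (Icc a b) := by
    have := lipschitzOnWith_integral_of_bound hhi hhb
    refine LipschitzOnWith.of_dist_le_mul fun x hx y hy => ?_
    rw [heq x hx, heq y hy, dist_add_left]
    exact this.dist_le_mul x hx y hy
  have hΦlip : ∀ x ∈ Icc a b, ∀ y ∈ Icc a b, ‖Φ x - Φ y‖ ≤ cΦ * ‖T‖ * ‖x - y‖ :=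
    fun x hx y hy => (convex_Icc a b).norm_image_sub_le_of_norm_hasDerivWithin_le
      (fun s _ => (hΦd s).hasDerivWithinAt)
      (fun s hs => by
        rw [norm_neg]
        exact (norm_mul_le _ _).trans (by gcongr; exact hcΦ s hs)) hy hx
  have hac1 : AbsolutelyContinuousOnInterval (fun s => Φ s (Z s)) a b := by
    refine LipschitzOnWith.absolutelyContinuousOnInterval
      (K := (cΦ * ‖T‖ * cZ + cΦ * (‖T‖ * cZ + G)).toNNReal) ?_
    rw [uIcc_of_le hab]
    refine LipschitzOnWith.of_dist_le_mul fun x hx y hy => ?_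
    rw [dist_eq_norm, Real.coe_toNNReal _ (by positivity), Real.dist_eq]
    have e : Φ x (Z x) - Φ y (Z y) = (Φ x - Φ y) (Z x) + Φ y (Z x - Z y) := by
      simp
    have h1 : ‖(Φ x - Φ y) (Z x)‖ ≤ cΦ * ‖T‖ * |x - y| * cZ :=
      (ContinuousLinearMap.le_opNorm _ _).trans
        (mul_le_mul (hΦlip x hx y hy) (hcZ x hx) (norm_nonneg _) (by positivity))
    have h2 : ‖Φ y (Z x - Z y)‖ ≤ cΦ * ((‖T‖ * cZ + G) * |x - y|) := by
      refine (ContinuousLinearMap.le_opNorm _ _).trans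
        (mul_le_mul (hcΦ y hy) ?_ (norm_nonneg _) (by positivity))
      have := hZlip.dist_le_mul x hx y hy
      rwa [dist_eq_norm, Real.coe_toNNReal _ (by positivity), Real.dist_eq] at this
    rw [e]
    refine (norm_add_le _ _).trans ((add_le_add h1 h2).trans (le_of_eq (by ring)))
  have hac2 : AbsolutelyContinuousOnInterval (fun s => ∫ r in a..s, k r) a b := by
    refine LipschitzOnWith.absolutelyContinuousOnInterval (K := (cΦ * G).toNNReal) ?_
    rw [uIcc_of_le hab]
    exact lipschitzOnWith_integral_of_bound hki hkb
  have hac : AbsolutelyContinuousOnInterval f a b := hac1.sub hac2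
  have hder : ∀ᵐ x, x ∈ uIcc a b → HasDerivAt f 0 x := by
    have na : ∀ᵐ x : ℝ, x ≠ a := by simp [ae_iff, measure_singleton]
    have nb : ∀ᵐ x : ℝ, x ≠ b := by simp [ae_iff, measure_singleton]
    filter_upwards [hki.ae_hasDerivAt_integral, hhi.ae_hasDerivAt_integral, na, nb]
      with x h1 h2 hxa hxb hx
    have hx' : x ∈ Ioo a b := by
      rw [uIcc_of_le hab] at hx
      exact ⟨lt_of_le_of_ne hx.1 hxa.symm, lt_of_le_of_ne hx.2 hxb⟩
    have hZd : HasDerivAt Z (h x) x := by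
      have := (h2 hx a left_mem_uIcc).const_add (Z a)
      refine this.congr_of_eventuallyEq ?_
      filter_upwards [Ioo_mem_nhds hx'.1 hx'.2] with y hy
      exact heq y (Ioo_subset_Icc_self hy)
    have h3 := ((hΦd x).clm_apply hZd).sub (h1 hx a left_mem_uIcc)
    convert h3 using 1
    simp [hh, hk]
  obtain ⟨C, hC⟩ := hac.const_of_ae_hasDerivAt_zero hder
  have e := (hC b right_mem_uIcc).trans (hC a left_mem_uIcc).symm
  simp only [hf, Pi.sub_apply, intervalIntegral.integral_same, sub_zero] at e
  have hΦb : Φ b (Z b) = Z b := by simp [hΦ]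
  rw [hΦb] at e
  exact sub_eq_iff_eq_add.1 e

end VariationOfConstants

/-! ### The time change defined by an admissible delay. -/

section Delay

variable {D : ℝ → ℝ}

theorem AdmissibleDelay.continuous_delayedTime (h : AdmissibleDelay D) :
    Continuous (delayedTime D) := continuous_id.sub h.cont

theorem AdmissibleDelay.hasDerivAt (h : AdmissibleDelay D) {t : ℝ} (ht : 0 < t) :
    HasDerivAt (delayedTime D) (deriv (delayedTime D) t) t :=
  ((h.contDiff.differentiableOn (by norm_num)).differentiableAt (Ioi_mem_nhds ht)).hasDerivAt

/-- Mean value inequality; continuity at `0` lets the interval be closed there although `φ` is only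
`C¹` for positive times. It yields strict monotonicity, the Lipschitz inverse and linear growth of
`φ`. -/
theorem AdmissibleDelay.exists_slope (h : AdmissibleDelay D) :
    ∃ c > 0, ∀ s t, 0 ≤ s → s ≤ t → c * (t - s) ≤ delayedTime D t - delayedTime D s := by
  obtain ⟨c, hc, hd⟩ := h.deriv_lower
  refine ⟨c, hc, fun s t hs hst =>
    (convex_Ici (0 : ℝ)).mul_sub_le_image_sub_of_le_deriv h.continuous_delayedTime.continuousOn
      ?_ ?_ s hs t (hs.trans hst) hst⟩
  · rw [interior_Ici]
    exact h.contDiff.differentiableOn (by norm_num)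
  · rw [interior_Ici]
    exact fun x hx => hd x hx

theorem AdmissibleDelay.strictMonoOn (h : AdmissibleDelay D) :
    StrictMonoOn (delayedTime D) (Ici 0) := by
  obtain ⟨c, hc, hs⟩ := h.exists_slope
  intro x hx y _ hxy
  have := hs x y hx hxy.le
  nlinarith [mul_pos hc (sub_pos.2 hxy)]

theorem AdmissibleDelay.delayedTime_lt (h : AdmissibleDelay D) (t : ℝ) : delayedTime D t < t := by
  have := h.pos t
  unfold delayedTime; linarith

theorem AdmissibleDelay.inv_delayedTime (h : AdmissibleDelay D) {t : ℝ} (ht : 0 ≤ t) :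
    delayedTimeInv D (delayedTime D t) = t := by
  have hm := h.strictMonoOn.monotoneOn self_mem_Ici (show t ∈ Ici (0 : ℝ) from ht) ht
  exact h.strictMonoOn.injOn (h.inv_spec hm).1 ht (h.inv_spec hm).2

theorem AdmissibleDelay.inv_le_inv (h : AdmissibleDelay D) {x y : ℝ} (hx : delayedTime D 0 ≤ x)
    (hxy : x ≤ y) : delayedTimeInv D x ≤ delayedTimeInv D y := by
  obtain ⟨h1, h2⟩ := h.inv_spec hx
  obtain ⟨h3, h4⟩ := h.inv_spec (hx.trans hxy)
  rwa [← h.strictMonoOn.le_iff_le h1 h3, h2, h4]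

theorem AdmissibleDelay.continuousOn_inv (h : AdmissibleDelay D) :
    ContinuousOn (delayedTimeInv D) (Ici (delayedTime D 0)) := by
  obtain ⟨c, hc, hs⟩ := h.exists_slope
  have key : ∀ x y, delayedTime D 0 ≤ x → x ≤ y →
      delayedTimeInv D y - delayedTimeInv D x ≤ c⁻¹ * (y - x) := by
    intro x y hx hxy
    obtain ⟨h1, h2⟩ := h.inv_spec hx
    obtain ⟨h3, h4⟩ := h.inv_spec (hx.trans hxy)
    have := hs _ _ h1 (h.inv_le_inv hx hxy)
    rw [h2, h4] at this
    rwa [inv_mul_eq_div, le_div_iff₀ hc, mul_comm]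
  refine LipschitzOnWith.continuousOn (K := c⁻¹.toNNReal) (LipschitzOnWith.of_dist_le_mul ?_)
  intro x hx y hy
  rw [Real.coe_toNNReal _ (by positivity), Real.dist_eq, Real.dist_eq]
  rcases le_total x y with hxy | hxy
  · rw [abs_sub_comm, abs_of_nonneg (sub_nonneg.2 (h.inv_le_inv hx hxy)), abs_sub_comm,
      abs_of_nonneg (sub_nonneg.2 hxy)]
    exact key x y hx hxy
  · rw [abs_of_nonneg (sub_nonneg.2 (h.inv_le_inv hy hxy)), abs_of_nonneg (sub_nonneg.2 hxy)]
    exact key y x hy hxy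

theorem AdmissibleDelay.le_inv (h : AdmissibleDelay D) {t : ℝ} (ht : delayedTime D 0 ≤ t) :
    t ≤ delayedTimeInv D t := by
  have := h.delayedTime_lt (delayedTimeInv D t)
  rw [(h.inv_spec ht).2] at this
  exact this.le

/-- The assumed bound starts only at `φ⁻¹(0)`; the compact interval before it is covered by
continuity. -/
theorem AdmissibleDelay.exists_upper (h : AdmissibleDelay D) :
    ∃ R > 0, ∀ t, 0 ≤ t → D t ≤ R := by
  obtain ⟨R₁, h1⟩ := h.bdd
  obtain ⟨R₂, h2⟩ := (isCompact_Icc (a := 0) (b := delayedTimeInv D 0)).bddAbove_image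
    h.cont.continuousOn
  have key : ∀ t, 0 ≤ t → D t ≤ max R₁ R₂ := by
    intro t ht
    rcases le_total (delayedTimeInv D 0) t with hle | hle
    · refine le_max_of_le_left (le_trans ?_ (h1 ⟨t, hle, rfl⟩))
      simp [delayedTime]
    · exact le_max_of_le_right (h2 ⟨t, ⟨ht, hle⟩, rfl⟩)
  exact ⟨max R₁ R₂, (h.pos 0).trans_le (key 0 le_rfl), key⟩

theorem AdmissibleDelay.exists_lower (h : AdmissibleDelay D) :
    ∃ r > 0, ∀ t, 0 ≤ t → r ≤ D t := by
  obtain ⟨r, hr, hl⟩ := h.lower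
  refine ⟨min r (D 0), lt_min hr (h.pos 0), fun t ht => ?_⟩
  rcases ht.eq_or_lt with rfl | ht
  · exact min_le_right _ _
  · have := hl t ht
    simp only [delayedTime, sub_sub_cancel] at this
    exact (min_le_left _ _).trans this

/-- Open intervals suffice for the change of variables and avoid the endpoint `0`, where
differentiability is not assumed. -/
theorem AdmissibleDelay.image_Ioo (h : AdmissibleDelay D) {t : ℝ} (ht : 0 ≤ t) :
    delayedTime D '' Ioo 0 t = Ioo (delayedTime D 0) (delayedTime D t) := by
  ext y
  constructor
  · rintro ⟨x, hx, rfl⟩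
    exact ⟨h.strictMonoOn self_mem_Ici hx.1.le hx.1, h.strictMonoOn hx.1.le ht hx.2⟩
  · rintro hy
    obtain ⟨h1, h2⟩ := h.inv_spec hy.1.le
    refine ⟨_, ⟨?_, ?_⟩, h2⟩
    · rw [← h.strictMonoOn.lt_iff_lt self_mem_Ici h1, h2]; exact hy.1
    · rw [← h.strictMonoOn.lt_iff_lt h1 ht, h2]; exact hy.2

section TimeChange

variable {E : Type*} [NormedAddCommGroup E] [NormedSpace ℝ E]

theorem AdmissibleDelay.intervalIntegrable_comp (h : AdmissibleDelay D) (F : ℝ → E) {t : ℝ}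
    (ht : 0 ≤ t) (hF : IntervalIntegrable F volume (delayedTime D 0) (delayedTime D t)) :
    IntervalIntegrable (fun s => deriv (delayedTime D) s • F (delayedTime D s)) volume 0 t := by
  have hm := h.strictMonoOn.monotoneOn self_mem_Ici (show t ∈ Ici (0 : ℝ) from ht) ht
  obtain ⟨c, hc, hd⟩ := h.deriv_lower
  rw [intervalIntegrable_iff_integrableOn_Ioo_of_le hm, ← h.image_Ioo ht,
    integrableOn_image_iff_integrableOn_abs_deriv_smul measurableSet_Ioo
      (fun x hx => (h.hasDerivAt hx.1).hasDerivWithinAt)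
      (h.strictMonoOn.injOn.mono fun x hx => hx.1.le)] at hF
  rw [intervalIntegrable_iff_integrableOn_Ioo_of_le ht]
  refine hF.congr_fun (fun x hx => ?_) measurableSet_Ioo
  simp only
  rw [abs_of_pos (hc.trans_le (hd x hx.1))]

theorem AdmissibleDelay.integral_comp (h : AdmissibleDelay D) (F : ℝ → E) {t : ℝ} (ht : 0 ≤ t) :
    ∫ s in (0 : ℝ)..t, deriv (delayedTime D) s • F (delayedTime D s) =
      ∫ r in (delayedTime D 0)..(delayedTime D t), F r := by
  have hm := h.strictMonoOn.monotoneOn self_mem_Ici (show t ∈ Ici (0 : ℝ) from ht) ht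
  obtain ⟨c, hc, hd⟩ := h.deriv_lower
  rw [intervalIntegral.integral_of_le hm, intervalIntegral.integral_of_le ht,
    integral_Ioc_eq_integral_Ioo, integral_Ioc_eq_integral_Ioo, ← h.image_Ioo ht,
    integral_image_eq_integral_abs_deriv_smul measurableSet_Ioo
      (fun x hx => (h.hasDerivAt hx.1).hasDerivWithinAt)
      (h.strictMonoOn.injOn.mono fun x hx => hx.1.le)]
  refine setIntegral_congr_fun measurableSet_Ioo fun x hx => ?_
  rw [abs_of_pos (hc.trans_le (hd x hx.1))]

end TimeChange

end Delay

/-! ### Matrices as operators, and exact formulas along closed-loop solutions. -/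

noncomputable section

section MulCLM

/-- Matrix multiplication as a continuous linear map between Euclidean spaces. -/
def mulCLM {a b : ℕ} (M : Matrix (Fin a) (Fin b) ℝ) : Vec b →L[ℝ] Vec a :=
  LinearMap.toContinuousLinearMap (Matrix.toEuclideanLin M)

theorem mulE_eq {a b : ℕ} (M : Matrix (Fin a) (Fin b) ℝ) (x : Vec b) : mulE M x = mulCLM M x :=
  rfl

theorem mulCLM_add {a b : ℕ} (M N : Matrix (Fin a) (Fin b) ℝ) :
    mulCLM (M + N) = mulCLM M + mulCLM N := by
  simp [mulCLM]

theorem mulCLM_sub {a b : ℕ} (M N : Matrix (Fin a) (Fin b) ℝ) :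
    mulCLM (M - N) = mulCLM M - mulCLM N := by
  simp [mulCLM]

theorem mulCLM_mul_apply {a b d : ℕ} (M : Matrix (Fin a) (Fin b) ℝ) (N : Matrix (Fin b) (Fin d) ℝ)
    (x : Vec d) : mulCLM (M * N) x = mulCLM M (mulCLM N x) := by
  ext i
  simp [mulCLM, Matrix.toEuclideanLin, Matrix.mulVec_mulVec]

end MulCLM

namespace DelaySystem

open NormedSpace

variable {n m p : ℕ} {S : DelaySystem n m p}

theorem flow_eq (r : ℝ) (x : Vec n) : S.flow r x = exp (r • mulCLM S.A) x := by
  have := congrArg (fun T : Vec n →L[ℝ] Vec n => T x) (toEuclideanCLM_exp_smul S.A r)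
  exact this

theorem add_ψ (S : DelaySystem n m p) (t : ℝ) : t + S.ψ t = delayedTimeInv S.D₁ t := by
  simp [ψ]

theorem Admissible.φ₁_zero_le (hS : S.Admissible) {t : ℝ} (ht : 0 ≤ t) :
    delayedTime S.D₁ 0 ≤ t := (hS.delay₁.delayedTime_lt 0).le.trans ht

theorem Admissible.ψ_eq (hS : S.Admissible) {t : ℝ} (ht : 0 ≤ t) :
    S.ψ t = S.D₁ (delayedTimeInv S.D₁ t) := by
  have := (hS.delay₁.inv_spec (hS.φ₁_zero_le ht)).2
  unfold delayedTime at this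
  unfold ψ
  linarith

theorem Admissible.continuousOn_ψ (hS : S.Admissible) : ContinuousOn S.ψ (Ici 0) :=
  (hS.delay₁.continuousOn_inv.mono fun _ hx => hS.φ₁_zero_le hx).sub continuousOn_id

namespace IsClosedLoop

variable {ψh : ℝ → ℝ} {Z ξ : ℝ → Vec n} {U : ℝ → Vec m}

theorem exists_input_bound (h : S.IsClosedLoop ψh Z ξ U) {f : ℝ → ℝ} (hf : Continuous f)
    (a b : ℝ) : ∃ G, ∀ s ∈ uIcc a b, ‖U (f s)‖ ≤ G := by
  obtain ⟨lo, hlo⟩ := (isCompact_uIcc (a := a) (b := b)).bddBelow_image hf.continuousOn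
  obtain ⟨hi, hhi⟩ := (isCompact_uIcc (a := a) (b := b)).bddAbove_image hf.continuousOn
  obtain ⟨G, hG⟩ := h.bdd_U lo hi
  exact ⟨G, fun s hs => hG ⟨f s, ⟨hlo ⟨s, hs, rfl⟩, hhi ⟨s, hs, rfl⟩⟩, rfl⟩⟩

theorem intervalIntegrable_input (h : S.IsClosedLoop ψh Z ξ U) {f : ℝ → ℝ} (hf : Continuous f)
    (a b : ℝ) : IntervalIntegrable (fun s => U (f s)) volume a b := by
  obtain ⟨G, hG⟩ := h.exists_input_bound hf a b
  rw [intervalIntegrable_iff]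
  refine Integrable.mono' (g := fun _ => G)
    (intervalIntegrable_iff.1 intervalIntegrable_const)
    (h.meas_U.comp hf.measurable).aestronglyMeasurable
    ((ae_restrict_iff' measurableSet_uIoc).2
      (Filter.Eventually.of_forall fun s hs => hG s (uIoc_subset_uIcc hs)))

theorem intervalIntegrable_forcing (h : S.IsClosedLoop ψh Z ξ U) {f : ℝ → ℝ} (hf : Continuous f)
    (a b : ℝ) : IntervalIntegrable (fun s => mulE S.B (U (f s))) volume a b := by
  exact intervalIntegrable_clm_apply (Φ := fun _ => mulCLM S.B) continuous_const
    (h.intervalIntegrable_input hf a b)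

theorem intervalIntegrable_plant (hS : S.Admissible) (h : S.IsClosedLoop ψh Z ξ U) {a b : ℝ}
    (ha : S.φ₂ 0 ≤ a) (hab : a ≤ b) :
    IntervalIntegrable (fun s => mulE S.A (Z s) + mulE S.B (U (S.φ₁ s))) volume a b := by
  refine IntervalIntegrable.add ?_
    (h.intervalIntegrable_forcing hS.delay₁.continuous_delayedTime a b)
  refine ContinuousOn.intervalIntegrable_of_Icc hab ?_
  exact (mulCLM S.A).continuous.comp_continuousOn
    (h.cont_Z.mono fun x hx => ha.trans hx.1)

theorem plant_sub (hS : S.Admissible) (h : S.IsClosedLoop ψh Z ξ U) {a b : ℝ}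
    (ha : S.φ₂ 0 ≤ a) (hab : a ≤ b) :
    Z b = Z a + ∫ s in a..b, (mulE S.A (Z s) + mulE S.B (U (S.φ₁ s))) := by
  rw [h.plant b (ha.trans hab), h.plant a ha, add_assoc,
    intervalIntegral.integral_add_adjacent_intervals (h.intervalIntegrable_plant hS le_rfl ha)
      (h.intervalIntegrable_plant hS ha hab)]

theorem plant_flow (hS : S.Admissible) (h : S.IsClosedLoop ψh Z ξ U) {a b : ℝ}
    (ha : S.φ₂ 0 ≤ a) (hab : a ≤ b) :
    Z b = S.flow (b - a) (Z a) + ∫ s in a..b, S.flow (b - s) (mulE S.B (U (S.φ₁ s))) := by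
  simp only [flow_eq]
  obtain ⟨G, hG⟩ := h.exists_input_bound hS.delay₁.continuous_delayedTime a b
  rw [uIcc_of_le hab] at hG
  refine variation_of_constants (mulCLM S.A) (g := fun s => mulE S.B (U (S.φ₁ s)))
    (G := ‖mulCLM S.B‖ * G) hab (h.cont_Z.mono fun x hx => ha.trans hx.1) ?_ ?_ ?_
  · exact (intervalIntegrable_iff_integrableOn_Icc_of_le hab).1
      (h.intervalIntegrable_forcing hS.delay₁.continuous_delayedTime a b)
  · exact fun s hs => ((mulCLM S.B).le_opNorm _).trans (by gcongr; exact hG s hs)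
  · exact fun t ht => h.plant_sub hS ha ht.1

theorem φ₂_zero_neg (hS : S.Admissible) : S.φ₂ 0 < 0 := hS.delay₂.delayedTime_lt 0

theorem φ₂_mono (hS : S.Admissible) {s t : ℝ} (hs : 0 ≤ s) (hst : s ≤ t) : S.φ₂ s ≤ S.φ₂ t :=
  hS.delay₂.strictMonoOn.monotoneOn hs (hs.trans hst) hst

/-- `Ẑ` is the variation-of-constants formula started from `ξ(t)` in place of `Z(φ₂(t))`, so the
input integrals cancel. -/
theorem state_sub_zHat (hS : S.Admissible) (h : S.IsClosedLoop ψh Z ξ U) {t : ℝ} (ht : 0 ≤ t) :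
    Z t - S.zHat ξ U t = S.flow (t - S.φ₂ t) (Z (S.φ₂ t) - ξ t) := by
  rw [h.plant_flow hS (φ₂_mono hS le_rfl ht) (hS.delay₂.delayedTime_lt t).le, zHat,
    add_sub_add_right_eq_sub, flow_eq, flow_eq, flow_eq, map_sub]

/-- In the time scale `φ₂`, the observer error follows the flow of `A - LC`. -/
theorem observer_error (hS : S.Admissible) (h : S.IsClosedLoop ψh Z ξ U) {t : ℝ} (ht : 0 ≤ t) :
    Z (S.φ₂ t) - ξ t =
      exp ((S.φ₂ t - S.φ₂ 0) • mulCLM (S.A - S.L * S.C)) (Z (S.φ₂ 0) - ξ 0) := by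
  set T := mulCLM (S.A - S.L * S.C) with hT
  set e : ℝ → Vec n := fun s => Z (S.φ₂ s) - ξ s with he
  have hφc : Continuous S.φ₂ := hS.delay₂.continuous_delayedTime
  have hec : ContinuousOn e (Ici 0) :=
    (h.cont_Z.comp hφc.continuousOn fun s hs => φ₂_mono hS le_rfl hs).sub h.cont_ξ
  -- The plant equation, rewritten in the variable `φ₂`, minus the observer equation: the inputs
  -- cancel and `A - LC` remains.
  have hinteg : ∀ s, 0 ≤ s → e s = e 0 + ∫ r in (0 : ℝ)..s, deriv S.φ₂ r • T (e r) := by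
    intro s hs
    have hmono := φ₂_mono hS le_rfl hs
    have i1 : IntervalIntegrable (fun r => deriv S.φ₂ r •
        (mulE S.A (Z (S.φ₂ r)) + mulE S.B (U (S.φ₁ (S.φ₂ r))))) volume 0 s :=
      hS.delay₂.intervalIntegrable_comp
      (fun s => mulE S.A (Z s) + mulE S.B (U (S.φ₁ s))) hs
      (h.intervalIntegrable_plant hS le_rfl hmono)
    have i2 : IntervalIntegrable (fun r => deriv S.φ₂ r • T (e r)) volume 0 s := by
      -- Integrability of `φ₂'` up to `0` comes from changing variables in the constant function
      -- `1`.
      have i3 := hS.delay₂.intervalIntegrable_comp (fun _ => (1 : ℝ)) hs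
        intervalIntegrable_const
      simp only [smul_eq_mul, mul_one] at i3
      refine i3.smul_continuousOn ?_
      rw [uIcc_of_le hs]
      exact T.continuous.comp_continuousOn (hec.mono fun x hx => hx.1)
    have e1 : (∫ r in (0 : ℝ)..s, deriv S.φ₂ r •
          (mulE S.A (Z (S.φ₂ r)) + mulE S.B (U (S.φ₁ (S.φ₂ r))))) =
        ∫ r in (S.φ₂ 0)..(S.φ₂ s), (mulE S.A (Z r) + mulE S.B (U (S.φ₁ r))) :=
      hS.delay₂.integral_comp (fun s => mulE S.A (Z s) + mulE S.B (U (S.φ₁ s))) hs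
    have e2 := h.plant_sub hS le_rfl hmono
    have e3 := h.observer s hs
    have e4 : ∫ r in (0 : ℝ)..s, deriv S.φ₂ r •
        (mulE S.A (ξ r) + mulE S.B (U (S.φ₁ (S.φ₂ r))) +
          mulE S.L (mulE S.C (Z (S.φ₂ r)) - mulE S.C (ξ r))) =
        (∫ r in (0 : ℝ)..s, deriv S.φ₂ r •
          (mulE S.A (Z (S.φ₂ r)) + mulE S.B (U (S.φ₁ (S.φ₂ r))))) -
        ∫ r in (0 : ℝ)..s, deriv S.φ₂ r • T (e r) := by
      rw [← intervalIntegral.integral_sub i1 i2]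
      refine intervalIntegral.integral_congr fun r _ => ?_
      simp only [hT, he]
      rw [← smul_sub]
      congr 1
      simp only [mulE_eq, mulCLM_sub, sub_apply, mulCLM_mul_apply, map_sub]
      abel
    rw [e4] at e3
    simp only [he]
    rw [e2, e3]
    rw [e1]
    abel
  -- Reparametrizing by `r = φ₂(s)` removes the factor `φ₂'`, leaving an autonomous equation without
  -- forcing.
  set η : ℝ → Vec n := fun r => e (delayedTimeInv S.D₂ r) with hη
  have hηφ : ∀ s, 0 ≤ s → η (S.φ₂ s) = e s := fun s hs => by
    simp only [hη]
    rw [show delayedTimeInv S.D₂ (S.φ₂ s) = s from hS.delay₂.inv_delayedTime hs]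
  have hmono := φ₂_mono hS le_rfl ht
  have key := variation_of_constants T (g := fun _ => (0 : Vec n)) (Z := η) (G := 0) hmono
    (hec.comp (hS.delay₂.continuousOn_inv.mono fun x hx => hx.1)
      fun r hr => (hS.delay₂.inv_spec hr.1).1)
    (integrable_zero _ _ _) (fun _ _ => by simp) (fun r hr => by
      obtain ⟨h1, h2⟩ := hS.delay₂.inv_spec hr.1
      have e1 := hS.delay₂.integral_comp (fun r => T (η r)) h1
      rw [h2] at e1
      simp only [add_zero]
      rw [hηφ 0 le_rfl]
      refine (hinteg _ h1).trans ?_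
      congr 1
      refine Eq.trans ?_ e1
      refine intervalIntegral.integral_congr fun x hx => ?_
      rw [uIcc_of_le h1] at hx
      rw [show η (delayedTime S.D₂ x) = e x from hηφ x hx.1]
      rfl)
  rw [hηφ t ht, hηφ 0 le_rfl] at key
  simpa only [map_zero, intervalIntegral.integral_zero, add_zero] using key

end IsClosedLoop

end DelaySystem

end

/-! ### Decay of the reconstruction error and accuracy of the predictors. -/

noncomputable section

namespace DelaySystem

open NormedSpace

variable {n m p : ℕ} {S : DelaySystem n m p}

namespace IsClosedLoop

/-- The reconstruction error decays exponentially, uniformly over all closed loops. -/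
theorem exists_reconstruction_decay (hS : S.Admissible) :
    ∃ c ≥ 0, ∃ l > 0, ∀ {ψh : ℝ → ℝ} {Z ξ : ℝ → Vec n} {U : ℝ → Vec m},
      S.IsClosedLoop ψh Z ξ U → ∀ t, 0 ≤ t →
        ‖Z t - S.zHat ξ U t‖ ≤ c * Real.exp (-l * t) * ‖Z 0 - S.zHat ξ U 0‖ := by
  obtain ⟨R, hR, hDR⟩ := hS.delay₂.exists_upper
  obtain ⟨cA, hcA1, hcA, -⟩ := exists_exp_smul_bound (mulCLM S.A) R
  obtain ⟨c, hc, l, hl, hdec⟩ := hS.hurwitz_observer.exists_exp_decay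
  obtain ⟨v, hv, hslope⟩ := hS.delay₂.exists_slope
  have hdelay : ∀ t, t - S.φ₂ t = S.D₂ t := fun t => by simp [φ₂, delayedTime]
  refine ⟨cA * c * cA, by positivity, l * v, by positivity, fun {ψh Z ξ U} h t ht => ?_⟩
  -- The flow over `D₂(0)` is inverted, because the final bound must be in terms of `Z(0) - Ẑ(0)`,
  -- which is what `Γ(0)` contains.
  have h0 : ‖Z (S.φ₂ 0) - ξ 0‖ ≤ cA * ‖Z 0 - S.zHat ξ U 0‖ := by
    have e := h.state_sub_zHat hS le_rfl
    have e' : exp ((-S.D₂ 0) • mulCLM S.A) (Z 0 - S.zHat ξ U 0) = Z (S.φ₂ 0) - ξ 0 := by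
      rw [e, hdelay, flow_eq]
      exact DFunLike.congr_fun (exp_neg_smul_mul_exp_smul (mulCLM S.A) (S.D₂ 0)) _
    rw [← e']
    refine (ContinuousLinearMap.le_opNorm _ _).trans ?_
    gcongr
    exact hcA _ ⟨by linarith [hDR 0 le_rfl], by linarith [hS.delay₂.pos 0]⟩
  have h1 : ‖Z (S.φ₂ t) - ξ t‖ ≤ c * Real.exp (-(l * v) * t) * ‖Z (S.φ₂ 0) - ξ 0‖ := by
    rw [h.observer_error hS ht]
    refine (ContinuousLinearMap.le_opNorm _ _).trans ?_
    refine mul_le_mul_of_nonneg_right ?_ (norm_nonneg _)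
    have hs : v * (t - 0) ≤ S.φ₂ t - S.φ₂ 0 := hslope 0 t le_rfl ht
    rw [sub_zero] at hs
    refine (hdec _ ((by positivity : 0 ≤ v * t).trans hs)).trans ?_
    refine mul_le_mul_of_nonneg_left (Real.exp_le_exp.2 ?_) hc.le
    nlinarith
  rw [h.state_sub_zHat hS ht, hdelay, flow_eq]
  refine (ContinuousLinearMap.le_opNorm _ _).trans ?_
  have h2 := hcA (S.D₂ t) ⟨by linarith [hS.delay₂.pos t], hDR t ht⟩
  calc _ ≤ cA * (c * Real.exp (-(l * v) * t) * (cA * ‖Z 0 - S.zHat ξ U 0‖)) := by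
        gcongr
        exact h1.trans (by gcongr)
    _ = _ := by ring

/-- Predictor and plant propagate with the same inputs over `[t, t + h]`; only their starting states
differ. -/
theorem predictorDirect_sub {ψh : ℝ → ℝ} {Z ξ : ℝ → Vec n} {U : ℝ → Vec m} (hS : S.Admissible)
    (hloop : S.IsClosedLoop ψh Z ξ U) {t h : ℝ} (ht : 0 ≤ t) (hh : 0 ≤ h) :
    S.predictorDirect h ξ U t - Z (t + h) = -S.flow h (Z t - S.zHat ξ U t) := by
  have ht' : S.φ₂ 0 ≤ t := (φ₂_zero_neg hS).le.trans ht
  rw [hloop.plant_flow hS ht' (by linarith : t ≤ t + h), predictorDirect,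
    add_sub_add_right_eq_sub, add_sub_cancel_left]
  simp only [flow_eq, map_sub, neg_sub]

/-- In the transport form the distributed input does not depend on the horizon, which enters only
through the flow and a scalar factor. Both are Lipschitz in it, although `U` may jump. -/
theorem norm_predictorTransport_sub_le {ψh : ℝ → ℝ} {Z ξ : ℝ → Vec n} {U : ℝ → Vec m}
    (hS : S.Admissible) (hloop : S.IsClosedLoop ψh Z ξ U) {R c : ℝ} (hc : 0 ≤ c)
    (hb : ∀ r ∈ Icc (-R) R, ‖exp (r • mulCLM S.A)‖ ≤ c)
    (hlip : ∀ r ∈ Icc (-R) R, ∀ s ∈ Icc (-R) R,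
      ‖exp (r • mulCLM S.A) - exp (s • mulCLM S.A)‖ ≤ c * |r - s|)
    {t h k ub : ℝ} (hh : h ∈ Icc 0 R) (hk : k ∈ Icc 0 R)
    (hub : ∀ y ∈ Icc (0 : ℝ) 1, ‖S.distInput U y t‖ ≤ ub) :
    ‖S.predictorTransport h ξ U t - S.predictorTransport k ξ U t‖ ≤
      c * |h - k| * (‖S.zHat ξ U t‖ + (1 + R) * ‖mulCLM S.B‖ * ub) := by
  have hcont : Continuous fun y : ℝ => S.φ₁ (t + y * S.ψ t) :=
    hS.delay₁.continuous_delayedTime.comp (by fun_prop)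
  have hint : ∀ r : ℝ, IntervalIntegrable
      (fun y => r • S.flow ((1 - y) * r) (mulE S.B (S.distInput U y t))) volume 0 1 := by
    intro r
    simp only [flow_eq]
    refine IntervalIntegrable.smul ?_ r
    refine intervalIntegrable_clm_apply (Φ := fun y => exp (((1 - y) * r) • mulCLM S.A)) ?_
      (hloop.intervalIntegrable_forcing hcont 0 1)
    exact (continuous_exp_smul (mulCLM S.A)).comp
      (by fun_prop : Continuous fun y : ℝ => (1 - y) * r)
  have hIcc : ∀ {x : ℝ}, x ∈ Icc 0 R → x ∈ Icc (-R) R := fun {x} hx =>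
    ⟨by linarith [hx.1, hx.2], hx.2⟩
  have hR : 0 ≤ R := hh.1.trans hh.2
  have hub0 : 0 ≤ ub := (norm_nonneg _).trans (hub 0 (by simp))
  have e : S.predictorTransport h ξ U t - S.predictorTransport k ξ U t =
      (exp (h • mulCLM S.A) - exp (k • mulCLM S.A)) (S.zHat ξ U t) +
      ∫ y in (0 : ℝ)..1, (h • S.flow ((1 - y) * h) (mulE S.B (S.distInput U y t)) -
        k • S.flow ((1 - y) * k) (mulE S.B (S.distInput U y t))) := by
    rw [intervalIntegral.integral_sub (hint h) (hint k), predictorTransport, predictorTransport,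
      sub_apply, flow_eq, flow_eq]
    abel
  have hI : ‖∫ y in (0 : ℝ)..1, (h • S.flow ((1 - y) * h) (mulE S.B (S.distInput U y t)) -
        k • S.flow ((1 - y) * k) (mulE S.B (S.distInput U y t)))‖ ≤
      (c * |h - k| * (1 + R) * (‖mulCLM S.B‖ * ub)) * |1 - 0| := by
    refine intervalIntegral.norm_integral_le_of_norm_le_const fun y hy => ?_
    rw [uIoc_of_le zero_le_one] at hy
    have hy' : y ∈ Icc (0 : ℝ) 1 := ⟨hy.1.le, hy.2⟩
    have hm : ∀ {x : ℝ}, x ∈ Icc 0 R → (1 - y) * x ∈ Icc (-R) R := fun {x} hx =>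
      hIcc ⟨mul_nonneg (by linarith [hy.2]) hx.1, by nlinarith [hx.1, hx.2, hy.1, hy.2]⟩
    have hv : ‖mulE S.B (S.distInput U y t)‖ ≤ ‖mulCLM S.B‖ * ub :=
      ((mulCLM S.B).le_opNorm _).trans (by gcongr; exact hub y hy')
    set v := mulE S.B (S.distInput U y t)
    have e2 : h • S.flow ((1 - y) * h) v - k • S.flow ((1 - y) * k) v =
        ((h - k) • exp (((1 - y) * h) • mulCLM S.A) + k • (exp (((1 - y) * h) • mulCLM S.A) -
          exp (((1 - y) * k) • mulCLM S.A))) v := by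
      simp only [flow_eq, add_apply, sub_apply, smul_apply, smul_sub, sub_smul]
      abel
    rw [e2]
    refine (ContinuousLinearMap.le_opNorm _ _).trans ?_
    refine mul_le_mul ?_ hv (norm_nonneg _) (by positivity)
    refine (norm_add_le _ _).trans ?_
    rw [norm_smul, norm_smul, Real.norm_eq_abs, Real.norm_eq_abs, abs_of_nonneg hk.1]
    have h1 := hb _ (hm hh)
    have h2 := hlip _ (hm hh) _ (hm hk)
    rw [← mul_sub, abs_mul, abs_of_nonneg (by linarith [hy.2] : (0 : ℝ) ≤ 1 - y)] at h2
    have h3 : c * ((1 - y) * |h - k|) ≤ c * |h - k| := by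
      gcongr
      exact mul_le_of_le_one_left (abs_nonneg _) (by linarith [hy.1])
    calc _ ≤ |h - k| * c + R * (c * |h - k|) := by
          gcongr
          · exact hk.2
          · exact h2.trans h3
      _ = _ := by ring
  rw [e]
  refine (norm_add_le _ _).trans ?_
  have h4 := (ContinuousLinearMap.le_opNorm (exp (h • mulCLM S.A) - exp (k • mulCLM S.A))
    (S.zHat ξ U t)).trans (mul_le_mul_of_nonneg_right (hlip h (hIcc hh) k (hIcc hk))
      (norm_nonneg _))
  refine (add_le_add h4 hI).trans (le_of_eq ?_)
  simp
  ring

/-- Both predictors are close to the exact future state `Z(φ₁⁻¹(t))`. -/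
theorem exists_predictor_error (hS : S.Admissible) :
    ∃ c ≥ 0, ∃ ε₀ > 0, ∀ {ψh : ℝ → ℝ} {Z ξ : ℝ → Vec n} {U : ℝ → Vec m},
      S.IsClosedLoop ψh Z ξ U → ∀ t h zb ub : ℝ, 0 ≤ t → |S.ψ t - h| ≤ ε₀ →
        (∀ s ∈ Icc t (delayedTimeInv S.D₁ t), ‖Z s‖ ≤ zb) →
        (∀ τ ∈ Icc (S.φ₁ t) t, ‖U τ‖ ≤ ub) →
        ‖S.predictorTransport h ξ U t - Z (delayedTimeInv S.D₁ t)‖ ≤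
            c * ‖Z t - S.zHat ξ U t‖ + c * |S.ψ t - h| * (zb + ub) ∧
        (h ≤ S.ψ t → ‖S.predictorDirect h ξ U t - Z (delayedTimeInv S.D₁ t)‖ ≤
            c * ‖Z t - S.zHat ξ U t‖ + c * |S.ψ t - h| * (zb + ub)) := by
  obtain ⟨R, hR, hDR⟩ := hS.delay₁.exists_upper
  obtain ⟨r, hr, hDr⟩ := hS.delay₁.exists_lower
  obtain ⟨c, hc1, hb, hlip⟩ := exists_exp_smul_bound (mulCLM S.A) (R + 1)
  have hc0 : 0 ≤ c := zero_le_one.trans hc1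
  set a := ‖mulCLM S.A‖
  set b := ‖mulCLM S.B‖
  -- One constant, summing what either predictor form needs. The tolerance `r` keeps `h`
  -- nonnegative, since `ψ ≥ r`; the tolerance `1` gives `h ≤ R + 1`.
  refine ⟨2 * c + c * (1 + (R + 1)) * b + a + b, by positivity, min r 1,
    lt_min hr one_pos, fun {ψh Z ξ U} hloop t h zb ub ht hh hzb hub => ?_⟩
  have hσ := hS.delay₁.inv_spec (hS.φ₁_zero_le ht)
  have hψ := hS.ψ_eq ht
  have hψr : r ≤ S.ψ t := hψ ▸ hDr _ hσ.1
  have hψR : S.ψ t ≤ R := hψ ▸ hDR _ hσ.1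
  have hh' := abs_le.1 hh
  have hh0 : 0 ≤ h := by linarith [hh'.2, min_le_left r 1]
  have hhR : h ≤ R + 1 := by linarith [hh'.1, min_le_right r 1]
  have habs1 : |S.ψ t - h| ≤ 1 := hh.trans (min_le_right _ _)
  have hσeq : delayedTimeInv S.D₁ t = t + S.ψ t := (S.add_ψ t).symm
  have htσ : t ≤ delayedTimeInv S.D₁ t := by rw [hσeq]; linarith
  have hz0 : 0 ≤ zb := (norm_nonneg _).trans (hzb t (left_mem_Icc.2 htσ))
  have hu0 : 0 ≤ ub := (norm_nonneg _).trans (hub t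
    (right_mem_Icc.2 (hS.delay₁.delayedTime_lt t).le))
  have hin : ∀ s ∈ Icc t (delayedTimeInv S.D₁ t), S.φ₁ s ∈ Icc (S.φ₁ t) t := by
    intro s hs
    have hm := hS.delay₁.strictMonoOn.monotoneOn
    refine ⟨hm ht (ht.trans hs.1) hs.1, ?_⟩
    have := hm (ht.trans hs.1) hσ.1 hs.2
    rwa [hσ.2] at this
  have hflow : ∀ k ∈ Icc 0 (R + 1), ‖S.flow k (Z t - S.zHat ξ U t)‖ ≤
      c * ‖Z t - S.zHat ξ U t‖ := by
    intro k hk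
    rw [flow_eq]
    refine (ContinuousLinearMap.le_opNorm _ _).trans ?_
    gcongr
    exact hb k ⟨by linarith [hk.1], hk.2⟩
  set δ := ‖Z t - S.zHat ξ U t‖ with hδ
  have hδ0 : 0 ≤ δ := norm_nonneg _
  have hψm : S.ψ t ∈ Icc 0 (R + 1) := ⟨by linarith, by linarith⟩
  constructor
  -- Transport form: compare with the exact horizon, where it agrees with the direct form.
  · have h1 := hloop.norm_predictorTransport_sub_le hS hc0 hb hlip (t := t) (ub := ub)
      ⟨hh0, hhR⟩ hψm (fun y hy => by
        refine hub _ (hin _ ⟨?_, ?_⟩)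
        · have := mul_nonneg hy.1 hψm.1
          linarith
        · rw [hσeq]
          have := mul_le_of_le_one_left hψm.1 hy.2
          linarith)
    have h2 := hloop.predictorDirect_sub hS ht hψm.1
    have h3 : ‖S.zHat ξ U t‖ ≤ zb + δ := by
      have e : S.zHat ξ U t = Z t - (Z t - S.zHat ξ U t) := by abel
      rw [e]
      refine (norm_sub_le _ _).trans (add_le_add_left (hzb t (left_mem_Icc.2 htσ)) _)
    have h4 : ‖S.predictorDirect (S.ψ t) ξ U t - Z (t + S.ψ t)‖ ≤ c * δ := by
      rw [h2, norm_neg]; exact hflow _ hψm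
    rw [hσeq, ← sub_add_sub_cancel _ (S.predictorTransport (S.ψ t) ξ U t)]
    refine (norm_add_le _ _).trans ?_
    rw [predictorTransport_exact S ξ U t] at h1 ⊢
    rw [abs_sub_comm] at h1
    refine (add_le_add h1 h4).trans ?_
    set x := |S.ψ t - h|
    have hx0 : 0 ≤ x := abs_nonneg _
    have hxδ : c * (x * δ) ≤ c * δ := by
      gcongr
      exact mul_le_of_le_one_left hδ0 habs1
    calc c * x * (‖S.zHat ξ U t‖ + (1 + (R + 1)) * b * ub) + c * δ
        ≤ c * x * ((zb + δ) + (1 + (R + 1)) * b * ub) + c * δ := by gcongr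
      _ = c * (x * δ) + c * δ + x * (c * zb + c * (1 + (R + 1)) * b * ub) := by ring
      _ ≤ c * δ + c * δ + x * (c * zb + c * (1 + (R + 1)) * b * ub) := by gcongr
      _ ≤ c * δ + c * δ + x * (c * zb + c * (1 + (R + 1)) * b * ub) +
          ((c * (1 + (R + 1)) * b + a + b) * δ + x * ((c + c * (1 + (R + 1)) * b + a + b) * zb +
            (2 * c + a + b) * ub)) := le_add_of_nonneg_right (by positivity)
      _ = _ := by ring
  · intro hle
    -- Direct form: it predicts `Z(t + h)`, and the plant equation bounds the motion over the
    -- remaining length `ψ(t) - h`. As `h ≤ ψ(t)`, only inputs from `[φ₁(t), t]` enter.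
    have h2 := hloop.predictorDirect_sub hS ht hh0
    have hth : S.φ₂ 0 ≤ t + h := (φ₂_zero_neg hS).le.trans (by linarith)
    have h3 := hloop.plant_sub hS hth (by linarith : t + h ≤ t + S.ψ t)
    have h4 : ‖∫ s in (t + h)..(t + S.ψ t), (mulE S.A (Z s) + mulE S.B (U (S.φ₁ s)))‖ ≤
        (a * zb + b * ub) * |(t + S.ψ t) - (t + h)| := by
      refine intervalIntegral.norm_integral_le_of_norm_le_const fun s hs => ?_
      rw [uIoc_of_le (by linarith)] at hs
      have hs' : s ∈ Icc t (delayedTimeInv S.D₁ t) := ⟨by linarith [hs.1], by rw [hσeq]; exact hs.2⟩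
      refine (norm_add_le _ _).trans (add_le_add ?_ ?_)
      · exact ((mulCLM S.A).le_opNorm _).trans (by gcongr; exact hzb s hs')
      · exact ((mulCLM S.B).le_opNorm _).trans (by gcongr; exact hub _ (hin s hs'))
    rw [add_sub_add_left_eq_sub] at h4
    rw [hσeq, h3, ← sub_sub, h2]
    refine (norm_sub_le _ _).trans ?_
    rw [norm_neg]
    refine (add_le_add (hflow h ⟨hh0, hhR⟩) h4).trans ?_
    set x := |S.ψ t - h|
    have hx0 : 0 ≤ x := abs_nonneg _
    calc c * δ + (a * zb + b * ub) * x
        ≤ c * δ + (a * zb + b * ub) * x + ((c + c * (1 + (R + 1)) * b + a + b) * δ +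
          x * ((2 * c + c * (1 + (R + 1)) * b + b) * zb +
            (2 * c + c * (1 + (R + 1)) * b + a) * ub)) := le_add_of_nonneg_right (by positivity)
      _ = _ := by ring

/-- Before the first closed-loop input arrives, the state is bounded by the initial data. -/
theorem exists_initial_bound (hS : S.Admissible) :
    ∃ c ≥ 0, ∀ {ψh : ℝ → ℝ} {Z ξ : ℝ → Vec n} {U : ℝ → Vec m},
      S.IsClosedLoop ψh Z ξ U → ∀ G : ℝ, ‖Z 0‖ ≤ G → (∀ τ ∈ Icc (S.φ₁ 0) 0, ‖U τ‖ ≤ G) →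
        ∀ s ∈ Icc 0 (delayedTimeInv S.D₁ 0), ‖Z s‖ ≤ c * G := by
  set s₀ := delayedTimeInv S.D₁ 0 with hs₀
  obtain ⟨c, hc1, hb, -⟩ := exists_exp_smul_bound (mulCLM S.A) s₀
  have hσ := hS.delay₁.inv_spec (hS.φ₁_zero_le le_rfl)
  refine ⟨c + c * ‖mulCLM S.B‖ * s₀, add_nonneg (by positivity)
    (mul_nonneg (by positivity) hσ.1), fun {ψh Z ξ U} hloop G hZ hU s hs => ?_⟩
  have hG : 0 ≤ G := (norm_nonneg _).trans hZ
  rw [hloop.plant_flow hS (φ₂_zero_neg hS).le hs.1]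
  have h1 : ‖S.flow (s - 0) (Z 0)‖ ≤ c * G := by
    rw [flow_eq]
    exact (ContinuousLinearMap.le_opNorm _ _).trans
      (mul_le_mul (hb _ ⟨by linarith [hs.1, hs.2], by linarith [hs.2]⟩) hZ (norm_nonneg _)
        (by positivity))
  have h2 : ‖∫ r in (0 : ℝ)..s, S.flow (s - r) (mulE S.B (U (S.φ₁ r)))‖ ≤
      c * (‖mulCLM S.B‖ * G) * |s - 0| := by
    refine intervalIntegral.norm_integral_le_of_norm_le_const fun r hr => ?_
    rw [uIoc_of_le hs.1] at hr
    rw [flow_eq]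
    refine (ContinuousLinearMap.le_opNorm _ _).trans (mul_le_mul
      (hb _ ⟨by linarith [hr.1, hr.2, hs.1, hs.2], by linarith [hr.1, hs.2]⟩) ?_ (norm_nonneg _)
        (by positivity))
    refine ((mulCLM S.B).le_opNorm _).trans ?_
    gcongr
    have hm := hS.delay₁.strictMonoOn.monotoneOn
    refine hU _ ⟨hm self_mem_Ici hr.1.le hr.1.le, ?_⟩
    have := hm (show r ∈ Ici (0 : ℝ) from hr.1.le) hσ.1 (hr.2.trans hs.2)
    rwa [hσ.2] at this
  rw [sub_zero s, abs_of_nonneg hs.1] at h2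
  refine (norm_add_le _ _).trans ((add_le_add h1 h2).trans ?_)
  calc c * G + c * (‖mulCLM S.B‖ * G) * s ≤ c * G + c * (‖mulCLM S.B‖ * G) * s₀ := by
        gcongr; exact hs.2
    _ = _ := by ring

end IsClosedLoop

end DelaySystem

end

/-! ### Small-gain argument and stability constants. -/

noncomputable section

theorem integral_exp_neg_le {κ a s : ℝ} (hκ : 0 < κ) :
    ∫ r in a..s, Real.exp (-κ * (s - r)) ≤ κ⁻¹ := by
  have hd : ∀ r ∈ uIcc a s, HasDerivAt (fun r => κ⁻¹ * Real.exp (-κ * (s - r)))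
      (Real.exp (-κ * (s - r))) r := by
    intro r _
    have h1 : HasDerivAt (fun r : ℝ => -κ * (s - r)) κ r := by
      simpa using ((hasDerivAt_id r).const_sub s).const_mul (-κ)
    refine (h1.exp.const_mul κ⁻¹).congr_deriv ?_
    field_simp
  rw [intervalIntegral.integral_eq_sub_of_hasDerivAt hd
    (Continuous.intervalIntegrable (by fun_prop) _ _)]
  have : 0 ≤ κ⁻¹ * Real.exp (-κ * (s - a)) := by positivity
  simp only [sub_self, mul_zero, Real.exp_zero, mul_one]
  linarith

theorem exp_neg_mul_le_exp_neg_mul {μ s t : ℝ} (hμ : 0 ≤ μ) (h : s ≤ t) :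
    Real.exp (-μ * t) ≤ Real.exp (-μ * s) :=
  Real.exp_le_exp.2 (mul_le_mul_of_nonpos_left h (neg_nonpos.2 hμ))

namespace DelaySystem

open NormedSpace

variable {n m p : ℕ} {S : DelaySystem n m p}

theorem sSup_sq_norm_nonneg (S : DelaySystem n m p) (U : ℝ → Vec m) (t : ℝ) :
    0 ≤ sSup ((fun τ => ‖U τ‖ ^ 2) '' Icc (S.φ₁ t) t) :=
  Real.sSup_nonneg (by rintro _ ⟨τ, _, rfl⟩; positivity)

theorem Γ_nonneg (S : DelaySystem n m p) (Z ξ : ℝ → Vec n) (U : ℝ → Vec m) (t : ℝ) :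
    0 ≤ S.Γ Z ξ U t := by
  have := S.sSup_sq_norm_nonneg U t
  unfold Γ
  positivity

namespace IsClosedLoop

/-- If the input tracks the exact predictor feedback up to an exponentially decaying error, then
the state decays exponentially. -/
theorem exists_state_decay (hS : S.Admissible) :
    ∃ l > 0, ∀ μ : ℝ, 0 ≤ μ → μ ≤ l / 2 → ∃ c ≥ 0,
      ∀ {ψh : ℝ → ℝ} {Z ξ : ℝ → Vec n} {U : ℝ → Vec m},
      S.IsClosedLoop ψh Z ξ U → ∀ T G δ : ℝ, 0 ≤ T → 0 ≤ δ →
        ‖Z (delayedTimeInv S.D₁ 0)‖ ≤ G →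
        (∀ t ∈ Ioc 0 T, ‖U t - mulE S.K (Z (delayedTimeInv S.D₁ t))‖ ≤ δ * Real.exp (-μ * t)) →
        ∀ s ∈ Icc (delayedTimeInv S.D₁ 0) (delayedTimeInv S.D₁ T),
          ‖Z s‖ ≤ c * (G + δ) * Real.exp (-μ * s) := by
  obtain ⟨R, hR, hDR⟩ := hS.delay₁.exists_upper
  obtain ⟨c, hc, l, hl, hdec⟩ := hS.hurwitz_feedback.exists_exp_decay
  have hσ0 := hS.delay₁.inv_spec (hS.φ₁_zero_le le_rfl)
  set s₀ := delayedTimeInv S.D₁ 0 with hs₀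
  have hs₀R : s₀ ≤ R := by
    have h1 := hDR s₀ hσ0.1
    have h2 := hσ0.2
    unfold delayedTime at h2
    linarith
  set b := ‖mulCLM S.B‖ with hb
  refine ⟨l, hl, fun μ hμ hμl => ⟨c * Real.exp (μ * R) * (1 + b * (2 / l)), by positivity,
    fun {ψh Z ξ U} hloop T G δ hT hδ hG htrack s hs => ?_⟩⟩
  have hG0 : 0 ≤ G := (norm_nonneg _).trans hG
  have hs0 : S.φ₂ 0 ≤ s₀ := (φ₂_zero_neg hS).le.trans hσ0.1
  have hσT := hS.delay₁.inv_spec (hS.φ₁_zero_le hT)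
  -- With this forcing the plant equation becomes `Ż = (A + BK) Z + g`.
  set g : ℝ → Vec n := fun r => mulCLM S.B (U (S.φ₁ r) - mulCLM S.K (Z r)) with hg
  have hZc : ContinuousOn Z (Icc s₀ s) := hloop.cont_Z.mono fun x hx => hs0.trans hx.1
  obtain ⟨GU, hGU⟩ := hloop.exists_input_bound hS.delay₁.continuous_delayedTime s₀ s
  rw [uIcc_of_le hs.1] at hGU
  obtain ⟨GZ, hGZ⟩ := isCompact_Icc.exists_bound_of_continuousOn hZc
  have hgi : IntervalIntegrable g volume s₀ s := by
    refine intervalIntegrable_clm_apply (Φ := fun _ => mulCLM S.B) continuous_const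
      ((hloop.intervalIntegrable_input hS.delay₁.continuous_delayedTime s₀ s).sub ?_)
    exact ((mulCLM S.K).continuous.comp_continuousOn hZc).intervalIntegrable_of_Icc hs.1
  have hvoc := variation_of_constants (mulCLM (S.A + S.B * S.K)) (g := g) (Z := Z)
    (G := b * (GU + ‖mulCLM S.K‖ * GZ)) hs.1 hZc
    ((intervalIntegrable_iff_integrableOn_Icc_of_le hs.1).1 hgi)
    (fun r hr => ((mulCLM S.B).le_opNorm _).trans (by
      gcongr
      exact (norm_sub_le _ _).trans (add_le_add (hGU r hr)
        (((mulCLM S.K).le_opNorm _).trans (by gcongr; exact hGZ r hr)))))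
    (fun t ht => by
      rw [hloop.plant_sub hS hs0 ht.1]
      congr 1
      refine intervalIntegral.integral_congr fun r _ => ?_
      simp only [hg, mulE_eq, mulCLM_add, add_apply, mulCLM_mul_apply, map_sub]
      abel)
  have h1 : ‖exp ((s - s₀) • mulCLM (S.A + S.B * S.K)) (Z s₀)‖ ≤
      c * Real.exp (μ * R) * G * Real.exp (-μ * s) := by
    refine (ContinuousLinearMap.le_opNorm _ _).trans ?_
    have h2 : ‖exp ((s - s₀) • mulCLM (S.A + S.B * S.K))‖ ≤
        c * (Real.exp (μ * R) * Real.exp (-μ * s)) := by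
      refine (hdec _ (sub_nonneg.2 hs.1)).trans (mul_le_mul_of_nonneg_left ?_ hc.le)
      rw [← Real.exp_add]
      refine Real.exp_le_exp.2 ?_
      have := mul_nonneg (by linarith : 0 ≤ l - μ) (sub_nonneg.2 hs.1)
      have := mul_le_mul_of_nonneg_left hs₀R hμ
      nlinarith
    calc _ ≤ c * (Real.exp (μ * R) * Real.exp (-μ * s)) * G :=
          mul_le_mul h2 hG (norm_nonneg _) (by positivity)
      _ = _ := by ring
  have h2 : ‖∫ r in s₀..s, exp ((s - r) • mulCLM (S.A + S.B * S.K)) (g r)‖ ≤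
      ∫ r in s₀..s, (c * b * δ * Real.exp (μ * R) * Real.exp (-μ * s)) *
        Real.exp (-(l / 2) * (s - r)) := by
    refine intervalIntegral.norm_integral_le_of_norm_le hs.1
      (Filter.Eventually.of_forall fun r hr => ?_)
      (Continuous.intervalIntegrable (by fun_prop) _ _)
    have hr0 : 0 ≤ r := hσ0.1.trans hr.1.le
    have hφ0 : 0 < S.φ₁ r := by
      have := hS.delay₁.strictMonoOn hσ0.1 hr0 hr.1
      rwa [hσ0.2] at this
    have hφT : S.φ₁ r ≤ T := by
      have := hS.delay₁.strictMonoOn.monotoneOn hr0 hσT.1 (hr.2.trans hs.2)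
      rwa [hσT.2] at this
    have h3 := htrack (S.φ₁ r) ⟨hφ0, hφT⟩
    rw [show delayedTimeInv S.D₁ (S.φ₁ r) = r from hS.delay₁.inv_delayedTime hr0] at h3
    have hφR : r - R ≤ S.φ₁ r := by
      have := hDR r hr0
      simp only [φ₁, delayedTime]
      linarith
    have h4 : ‖g r‖ ≤ b * (δ * Real.exp (-μ * S.φ₁ r)) :=
      ((mulCLM S.B).le_opNorm _).trans (mul_le_mul_of_nonneg_left h3 (norm_nonneg _))
    have h5 := hdec _ (sub_nonneg.2 hr.2)
    refine (ContinuousLinearMap.le_opNorm _ _).trans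
      ((mul_le_mul h5 h4 (norm_nonneg _) (by positivity)).trans ?_)
    -- The rate `l` is split: one half dominates `μ` and carries the envelope to time `s`, the other
    -- keeps the integral below `2/l` on every horizon.
    have h6 : Real.exp (-l * (s - r)) * Real.exp (-μ * S.φ₁ r) ≤
        Real.exp (μ * R) * Real.exp (-μ * s) * Real.exp (-(l / 2) * (s - r)) := by
      rw [← Real.exp_add, ← Real.exp_add, ← Real.exp_add]
      refine Real.exp_le_exp.2 ?_
      have := mul_nonneg (by linarith : 0 ≤ l / 2 - μ) (sub_nonneg.2 hr.2)
      have := mul_le_mul_of_nonneg_left hφR hμ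
      nlinarith
    calc c * Real.exp (-l * (s - r)) * (b * (δ * Real.exp (-μ * S.φ₁ r)))
        = c * b * δ * (Real.exp (-l * (s - r)) * Real.exp (-μ * S.φ₁ r)) := by ring
      _ ≤ c * b * δ * (Real.exp (μ * R) * Real.exp (-μ * s) * Real.exp (-(l / 2) * (s - r))) := by
          gcongr
      _ = _ := by ring
  rw [intervalIntegral.integral_const_mul] at h2
  have h3 : ‖∫ r in s₀..s, exp ((s - r) • mulCLM (S.A + S.B * S.K)) (g r)‖ ≤
      (c * b * δ * Real.exp (μ * R) * Real.exp (-μ * s)) * (2 / l) := by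
    refine h2.trans (mul_le_mul_of_nonneg_left ?_ (by positivity))
    refine (integral_exp_neg_le (by positivity)).trans (le_of_eq ?_)
    rw [inv_div]
  rw [hvoc]
  refine (norm_add_le _ _).trans ((add_le_add h1 h3).trans ?_)
  have h4 : 0 ≤ c * Real.exp (μ * R) * Real.exp (-μ * s) * (δ + b * (2 / l) * G) := by positivity
  calc _ ≤ _ := le_add_of_nonneg_right h4
    _ = _ := by ring

/-- For accurate horizons, the input tracks the exact predictor feedback up to a small multiple of
any exponential envelope for state and input. -/
theorem exists_tracking_error (hS : S.Admissible) :
    ∃ l > 0, ∀ μ : ℝ, 0 ≤ μ → μ ≤ l → ∃ c ≥ 0, ∃ ε₀ > 0,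
      ∀ {ψh : ℝ → ℝ} {Z ξ : ℝ → Vec n} {U : ℝ → Vec m}, S.IsClosedLoop ψh Z ξ U →
        ∀ ε : ℝ, ε ≤ ε₀ → (∀ t ≥ 0, |S.ψ t - ψh t| ≤ ε) → ∀ T G N : ℝ, 0 ≤ N →
        ‖Z 0 - S.zHat ξ U 0‖ ≤ G →
        (∀ s ∈ Icc 0 (delayedTimeInv S.D₁ T), ‖Z s‖ ≤ N * Real.exp (-μ * s)) →
        (∀ τ ∈ Icc (S.φ₁ 0) T, ‖U τ‖ ≤ N * Real.exp (-μ * τ)) →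
        ∀ t ∈ Ioc 0 T, ‖U t - mulE S.K (Z (delayedTimeInv S.D₁ t))‖ ≤
          c * (G + ε * N) * Real.exp (-μ * t) := by
  obtain ⟨R, hR, hDR⟩ := hS.delay₁.exists_upper
  obtain ⟨cO, hcO, l, hl, hO⟩ := exists_reconstruction_decay hS
  obtain ⟨cP, hcP, ε₀, hε₀, hP⟩ := exists_predictor_error hS
  set k := ‖mulCLM S.K‖ with hk
  refine ⟨l, hl, fun μ hμ0 hμl => ⟨k * (cP * (cO + (1 + Real.exp (μ * R)))), by positivity, ε₀,
    hε₀, fun {ψh Z ξ U} hloop ε hε hψ T G N hN hZh0 hZN hUN t ht => ?_⟩⟩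
  have hG : 0 ≤ G := (norm_nonneg _).trans hZh0
  have hε0 : 0 ≤ ε := (abs_nonneg _).trans (hψ 0 le_rfl)
  have hdecay : ‖Z t - S.zHat ξ U t‖ ≤ cO * G * Real.exp (-μ * t) := by
    have h1 : Real.exp (-l * t) ≤ Real.exp (-μ * t) :=
      Real.exp_le_exp.2 (mul_le_mul_of_nonneg_right (neg_le_neg hμl) ht.1.le)
    calc _ ≤ cO * Real.exp (-l * t) * ‖Z 0 - S.zHat ξ U 0‖ := hO hloop t ht.1.le
      _ ≤ cO * Real.exp (-μ * t) * G := by gcongr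
      _ = _ := by ring
  have hφ : t - R ≤ S.φ₁ t := by
    have := hDR t ht.1.le
    simp only [φ₁, delayedTime]
    linarith
  -- The prediction at `t` involves states up to `φ₁⁻¹(t)`, hence the longer state horizon; inputs
  -- from as far back as `t - R` cost the factor `exp (μ R)`.
  have herr := hP hloop t (ψh t) (N * Real.exp (-μ * t))
    (N * (Real.exp (μ * R) * Real.exp (-μ * t))) ht.1.le ((hψ t ht.1.le).trans hε)
    (fun s hs => (hZN s ⟨ht.1.le.trans hs.1,
        hs.2.trans (hS.delay₁.inv_le_inv (hS.φ₁_zero_le ht.1.le) ht.2)⟩).trans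
      (mul_le_mul_of_nonneg_left (exp_neg_mul_le_exp_neg_mul hμ0 hs.1) hN))
    (fun τ hτ => by
      refine (hUN τ ⟨(hS.delay₁.strictMonoOn.monotoneOn self_mem_Ici
        (show t ∈ Ici (0 : ℝ) from ht.1.le) ht.1.le).trans hτ.1, hτ.2.trans ht.2⟩).trans
        (mul_le_mul_of_nonneg_left ?_ hN)
      refine (exp_neg_mul_le_exp_neg_mul hμ0 (hφ.trans hτ.1)).trans (le_of_eq ?_)
      rw [← Real.exp_add]
      ring_nf)
  have hbd : cP * ‖Z t - S.zHat ξ U t‖ + cP * |S.ψ t - ψh t| *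
      (N * Real.exp (-μ * t) + N * (Real.exp (μ * R) * Real.exp (-μ * t))) ≤
      cP * (cO + (1 + Real.exp (μ * R))) * (G + ε * N) * Real.exp (-μ * t) := by
    calc _ ≤ cP * (cO * G * Real.exp (-μ * t)) + cP * ε *
          (N * Real.exp (-μ * t) + N * (Real.exp (μ * R) * Real.exp (-μ * t))) := by
          gcongr
          exact hψ t ht.1.le
      _ ≤ cP * (cO * G * Real.exp (-μ * t)) + cP * ε *
          (N * Real.exp (-μ * t) + N * (Real.exp (μ * R) * Real.exp (-μ * t))) +
          cP * (cO * ε * N + (1 + Real.exp (μ * R)) * G) * Real.exp (-μ * t) :=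
          le_add_of_nonneg_right (by positivity)
      _ = _ := by ring
  have hfin : ∀ P : Vec n, U t = mulE S.K P → ‖P - Z (delayedTimeInv S.D₁ t)‖ ≤
      cP * (cO + (1 + Real.exp (μ * R))) * (G + ε * N) * Real.exp (-μ * t) →
      ‖U t - mulE S.K (Z (delayedTimeInv S.D₁ t))‖ ≤
        k * (cP * (cO + (1 + Real.exp (μ * R)))) * (G + ε * N) * Real.exp (-μ * t) := by
    intro P hP1 hP2
    rw [hP1, mulE_eq, mulE_eq, ← map_sub]
    refine ((mulCLM S.K).le_opNorm _).trans
      ((mul_le_mul_of_nonneg_left hP2 (norm_nonneg _)).trans (le_of_eq ?_))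
    ring
  rcases hloop.feedback t ht.1 with hf | ⟨hle, hf⟩
  · exact hfin _ hf (herr.1.trans hbd)
  · exact hfin _ hf ((herr.2 hle).trans hbd)

/-- For accurate horizons, an exponential envelope for state and input contracts towards a
multiple of the size of the initial data. -/
theorem exists_envelope_contraction (hS : S.Admissible) :
    ∃ l > 0, ∀ μ : ℝ, 0 ≤ μ → μ ≤ l → ∃ εs > 0, ∃ α ≥ 0,
      ∀ {ψh : ℝ → ℝ} {Z ξ : ℝ → Vec n} {U : ℝ → Vec m},
      S.IsClosedLoop ψh Z ξ U → (∀ t ≥ 0, |S.ψ t - ψh t| ≤ εs) → ∀ T G N : ℝ, 0 ≤ T →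
        ‖Z 0‖ ≤ G → ‖Z 0 - S.zHat ξ U 0‖ ≤ G → (∀ τ ∈ Icc (S.φ₁ 0) 0, ‖U τ‖ ≤ G) →
        (∀ s ∈ Icc 0 (delayedTimeInv S.D₁ T), ‖Z s‖ ≤ N * Real.exp (-μ * s)) →
        (∀ τ ∈ Icc (S.φ₁ 0) T, ‖U τ‖ ≤ N * Real.exp (-μ * τ)) →
        (∀ s ∈ Icc 0 (delayedTimeInv S.D₁ T), ‖Z s‖ ≤ (α * G + N / 2) * Real.exp (-μ * s)) ∧
        (∀ τ ∈ Icc (S.φ₁ 0) T, ‖U τ‖ ≤ (α * G + N / 2) * Real.exp (-μ * τ)) := by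
  obtain ⟨cI, hcI, hI⟩ := exists_initial_bound hS
  obtain ⟨l₀, hl₀, hP⟩ := exists_tracking_error hS
  obtain ⟨l, hl, hD⟩ := exists_state_decay hS
  refine ⟨min l₀ (l / 2), lt_min hl₀ (by positivity), fun μ hμ0 hμl => ?_⟩
  obtain ⟨cD, hcD, hD⟩ := hD μ hμ0 (hμl.trans (min_le_right _ _))
  obtain ⟨cP, hcP, ε₀, hε₀, hP⟩ := hP μ hμ0 (hμl.trans (min_le_left _ _))
  have hσ0 := hS.delay₁.inv_spec (hS.φ₁_zero_le le_rfl)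
  set σ₀ := delayedTimeInv S.D₁ 0 with hσ₀
  set k := ‖mulCLM S.K‖ with hk
  have hk0 : 0 ≤ k := norm_nonneg _
  -- This number dominates the coefficient of `ε N` in both the state and the input bound. The
  -- tolerance makes its product with `ε` at most `1/2`; the `+ 1` there avoids a zero denominator.
  have hβ0 : 0 ≤ (cD + k * cD + 1) * cP := by positivity
  have hεs0 : 0 < min ε₀ (1 / (2 * ((cD + k * cD + 1) * cP + 1))) :=
    lt_min hε₀ (by positivity)
  have hεβ : min ε₀ (1 / (2 * ((cD + k * cD + 1) * cP + 1))) * ((cD + k * cD + 1) * cP) ≤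
      1 / 2 := by
    have h1 := min_le_right ε₀ (1 / (2 * ((cD + k * cD + 1) * cP + 1)))
    rw [le_div_iff₀ (by positivity)] at h1
    linarith
  have hle₀ := min_le_left ε₀ (1 / (2 * ((cD + k * cD + 1) * cP + 1)))
  generalize min ε₀ (1 / (2 * ((cD + k * cD + 1) * cP + 1))) = εs at hεs0 hεβ hle₀
  refine ⟨εs, hεs0, cI * Real.exp (μ * σ₀) + (cD + k * cD) * (cI + cP) + cP + 1, by positivity,
    fun {ψh Z ξ U} hloop hψ T G N hT hZ0 hZh0 hU0 hZN hUN => ?_⟩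
  have hG : 0 ≤ G := (norm_nonneg _).trans hZ0
  have hN : 0 ≤ N := by
    have := (norm_nonneg _).trans
      (hZN 0 (left_mem_Icc.2 (hS.delay₁.inv_spec (hS.φ₁_zero_le hT)).1))
    simpa using this
  have htrack := hP hloop εs hle₀ hψ T G N hN hZh0 hZN hUN
  set δ := cP * (G + εs * N) with hδ
  have hδ0 : 0 ≤ δ := by positivity
  have hinit := hI hloop G hZ0 hU0
  have hstate := hD hloop T (cI * G) δ hT hδ0 (hinit _ (right_mem_Icc.2 hσ0.1)) htrack
  have hεN : εs * ((cD + k * cD + 1) * cP) * N ≤ N / 2 := by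
    calc _ ≤ 1 / 2 * N := by gcongr
      _ = _ := by ring
  clear hP hI hD hZN hUN hεβ hψ
  refine ⟨fun s hs => ?_, fun τ hτ => ?_⟩
  · rcases le_total s σ₀ with hle | hle
    · have h1 := hinit s ⟨hs.1, hle⟩
      have h2 : 1 ≤ Real.exp (μ * σ₀) * Real.exp (-μ * s) := by
        rw [← Real.exp_add]
        refine Real.one_le_exp ?_
        have := mul_le_mul_of_nonneg_left hle hμ0
        linarith
      have h3 : 0 ≤ ((cD + k * cD) * (cI + cP) + cP + 1) * G + N / 2 := by positivity
      calc ‖Z s‖ ≤ cI * G * 1 := by rw [mul_one]; exact h1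
        _ ≤ cI * G * (Real.exp (μ * σ₀) * Real.exp (-μ * s)) := by gcongr
        _ = (cI * Real.exp (μ * σ₀) * G) * Real.exp (-μ * s) := by ring
        _ ≤ _ := mul_le_mul_of_nonneg_right (by linarith) (Real.exp_pos _).le
    · refine (hstate s ⟨hle, hs.2⟩).trans
        (mul_le_mul_of_nonneg_right ?_ (Real.exp_pos _).le)
      have h3 : 0 ≤ (cI * Real.exp (μ * σ₀) + k * cD * (cI + cP) + cP + 1) * G +
        εs * ((k * cD + 1) * cP) * N := by positivity
      linarith
  · rcases le_or_gt τ 0 with hle | hlt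
    · have h1 : 1 ≤ Real.exp (-μ * τ) :=
        Real.one_le_exp (mul_nonneg_of_nonpos_of_nonpos (neg_nonpos.2 hμ0) hle)
      have h3 : 0 ≤ (cI * Real.exp (μ * σ₀) + (cD + k * cD) * (cI + cP) + cP) * G + N / 2 := by
        positivity
      have h4 : G ≤ (cI * Real.exp (μ * σ₀) + (cD + k * cD) * (cI + cP) + cP + 1) * G + N / 2 := by
        linarith
      exact (hU0 τ ⟨hτ.1, hle⟩).trans (h4.trans (le_mul_of_one_le_right (hG.trans h4) h1))
    · have h1 := hstate (delayedTimeInv S.D₁ τ)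
        ⟨hS.delay₁.inv_le_inv (hS.φ₁_zero_le le_rfl) hlt.le,
          hS.delay₁.inv_le_inv (hS.φ₁_zero_le hlt.le) hτ.2⟩
      -- Since `φ₁⁻¹(τ) ≥ τ`, the envelope of the future state lies below its value at `τ`.
      have h2 : ‖Z (delayedTimeInv S.D₁ τ)‖ ≤ cD * (cI * G + δ) * Real.exp (-μ * τ) :=
        h1.trans (mul_le_mul_of_nonneg_left
          (exp_neg_mul_le_exp_neg_mul hμ0 (hS.delay₁.le_inv (hS.φ₁_zero_le hlt.le)))
          (by positivity))
      have h3 : ‖U τ‖ ≤ k * (cD * (cI * G + δ) * Real.exp (-μ * τ)) + δ * Real.exp (-μ * τ) := by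
        have e : U τ = mulE S.K (Z (delayedTimeInv S.D₁ τ)) +
          (U τ - mulE S.K (Z (delayedTimeInv S.D₁ τ))) := by abel
        rw [e]
        refine (norm_add_le _ _).trans (add_le_add ?_ (htrack τ ⟨hlt, hτ.2⟩))
        exact ((mulCLM S.K).le_opNorm _).trans (mul_le_mul_of_nonneg_left h2 (norm_nonneg _))
      refine h3.trans ?_
      rw [← mul_assoc, ← add_mul]
      refine mul_le_mul_of_nonneg_right ?_ (Real.exp_pos _).le
      have h4 : 0 ≤ (cI * Real.exp (μ * σ₀) + cD * (cI + cP) + 1) * G +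
        εs * (cD * cP) * N := by positivity
      linarith

/-- Uniform exponential stability for all closed loops with an accurate horizon. -/
theorem exists_Γ_decay (hS : S.Admissible) :
    ∃ εs > 0, ∃ l > 0, ∃ M > 0, ∀ {ψh : ℝ → ℝ} {Z ξ : ℝ → Vec n} {U : ℝ → Vec m},
      S.IsClosedLoop ψh Z ξ U → (∀ t ≥ 0, |S.ψ t - ψh t| ≤ εs) → ∀ t, 0 ≤ t →
        S.Γ Z ξ U t ≤ M * Real.exp (-l * t) * S.Γ Z ξ U 0 := by
  obtain ⟨R, hR, hDR⟩ := hS.delay₁.exists_upper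
  obtain ⟨cO, hcO, l₀, hl₀, hO⟩ := exists_reconstruction_decay hS
  obtain ⟨l₁, hl₁, hC⟩ := exists_envelope_contraction hS
  set μ := min l₀ l₁ with hμ
  have hμ0 : 0 < μ := lt_min hl₀ hl₁
  obtain ⟨εs, hεs, α, hα, hC⟩ := hC μ hμ0.le (min_le_right _ _)
  -- The rate doubles because `Γ` is quadratic; the final `+ 1` only makes `M` positive.
  refine ⟨εs, hεs, 2 * μ, by positivity,
    (2 * α) ^ 2 + cO ^ 2 + (2 * α * Real.exp (μ * R)) ^ 2 + 1, by positivity,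
    fun {ψh Z ξ U} hloop hψ T hT => ?_⟩
  have hφ0 : S.φ₁ 0 < 0 := hS.delay₁.delayedTime_lt 0
  have hbdd : ∀ t, BddAbove ((fun τ => ‖U τ‖ ^ 2) '' Icc (S.φ₁ t) t) := by
    intro t
    obtain ⟨G, hG⟩ := hloop.bdd_U (S.φ₁ t) t
    refine ⟨G ^ 2, ?_⟩
    rintro _ ⟨τ, hτ, rfl⟩
    have := hG ⟨τ, hτ, rfl⟩
    simp only at this ⊢
    gcongr
  have hsup0 := S.sSup_sq_norm_nonneg U 0
  set Γ₀ := S.Γ Z ξ U 0 with hΓ₀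
  have hΓ0 : 0 ≤ Γ₀ := S.Γ_nonneg Z ξ U 0
  set G := Real.sqrt Γ₀ with hGdef
  have hG0 : 0 ≤ G := Real.sqrt_nonneg _
  have hGsq : G ^ 2 = Γ₀ := Real.sq_sqrt hΓ0
  have hZ0 : ‖Z 0‖ ≤ G := by
    refine Real.le_sqrt_of_sq_le ?_
    rw [hΓ₀, Γ]
    nlinarith [sq_nonneg ‖Z 0 - S.zHat ξ U 0‖]
  have hZh0 : ‖Z 0 - S.zHat ξ U 0‖ ≤ G := by
    refine Real.le_sqrt_of_sq_le ?_
    rw [hΓ₀, Γ]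
    nlinarith [sq_nonneg ‖Z 0‖]
  have hU0 : ∀ τ ∈ Icc (S.φ₁ 0) 0, ‖U τ‖ ≤ G := by
    intro τ hτ
    refine Real.le_sqrt_of_sq_le ?_
    have h1 := le_csSup (hbdd 0) (mem_image_of_mem (fun τ => ‖U τ‖ ^ 2) hτ)
    rw [hΓ₀, Γ]
    nlinarith [sq_nonneg ‖Z 0‖, sq_nonneg ‖Z 0 - S.zHat ξ U 0‖]
  have hσT := hS.delay₁.inv_spec (hS.φ₁_zero_le hT)
  have hTσ := hS.delay₁.le_inv (hS.φ₁_zero_le hT)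
  set P : Set ℝ := (fun s => ‖Z s‖ * Real.exp (μ * s)) '' Icc 0 (delayedTimeInv S.D₁ T) ∪
    (fun τ => ‖U τ‖ * Real.exp (μ * τ)) '' Icc (S.φ₁ 0) T with hP
  have hPb : BddAbove P := by
    refine BddAbove.union ?_ ?_
    · refine isCompact_Icc.bddAbove_image (ContinuousOn.mul ?_ (by fun_prop))
      exact (hloop.cont_Z.mono fun x hx => (φ₂_zero_neg hS).le.trans hx.1).norm
    · obtain ⟨B, hB⟩ := hloop.bdd_U (S.φ₁ 0) T
      refine ⟨B * Real.exp (μ * T), ?_⟩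
      rintro _ ⟨τ, hτ, rfl⟩
      have h1 : ‖U τ‖ ≤ B := hB ⟨τ, hτ, rfl⟩
      exact mul_le_mul h1 (Real.exp_le_exp.2 (mul_le_mul_of_nonneg_left hτ.2 hμ0.le))
        (Real.exp_pos _).le ((norm_nonneg _).trans h1)
  have hexp : ∀ x y s : ℝ, x * Real.exp (μ * s) ≤ y ↔ x ≤ y * Real.exp (-μ * s) := by
    intro x y s
    rw [neg_mul, Real.exp_neg, ← div_eq_mul_inv, le_div_iff₀ (Real.exp_pos _)]
  -- The contraction is applied to the smallest valid envelope; its finiteness allows half of it to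
  -- be absorbed on the left.
  have hle : sSup P ≤ α * G + sSup P / 2 := by
    obtain ⟨h1, h2⟩ := hC hloop hψ T G (sSup P) hT hZ0 hZh0 hU0
      (fun s hs => (hexp _ _ _).1 (le_csSup hPb (Or.inl ⟨s, hs, rfl⟩)))
      (fun τ hτ => (hexp _ _ _).1 (le_csSup hPb (Or.inr ⟨τ, hτ, rfl⟩)))
    refine csSup_le ⟨_, Or.inl ⟨0, left_mem_Icc.2 hσT.1, rfl⟩⟩ ?_
    rintro _ (⟨s, hs, rfl⟩ | ⟨τ, hτ, rfl⟩)
    · exact (hexp _ _ _).2 (h1 s hs)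
    · exact (hexp _ _ _).2 (h2 τ hτ)
  have hle2 : sSup P ≤ 2 * α * G := by linarith
  set E := Real.exp (-μ * T) with hE
  have hE0 : 0 < E := Real.exp_pos _
  have hEsq : Real.exp (-(2 * μ) * T) = E ^ 2 := by
    rw [hE, ← Real.exp_nat_mul]
    congr 1
    push_cast
    ring
  have hZT : ‖Z T‖ ≤ 2 * α * G * E :=
    (hexp _ _ _).1 ((le_csSup hPb (Or.inl ⟨T, ⟨hT, hTσ⟩, rfl⟩)).trans hle2)
  have hZhT : ‖Z T - S.zHat ξ U T‖ ≤ cO * G * E := by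
    have h1 : Real.exp (-l₀ * T) ≤ E :=
      Real.exp_le_exp.2 (mul_le_mul_of_nonneg_right (neg_le_neg (min_le_left _ _)) hT)
    calc _ ≤ cO * Real.exp (-l₀ * T) * ‖Z 0 - S.zHat ξ U 0‖ := hO hloop T hT
      _ ≤ cO * E * G := by gcongr
      _ = _ := by ring
  have hφT : T - R ≤ S.φ₁ T := by
    have := hDR T hT
    simp only [φ₁, delayedTime]
    linarith
  have hUT : sSup ((fun τ => ‖U τ‖ ^ 2) '' Icc (S.φ₁ T) T) ≤
      (2 * α * G * (Real.exp (μ * R) * E)) ^ 2 := by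
    refine csSup_le ⟨_, T, right_mem_Icc.2 (hS.delay₁.delayedTime_lt T).le, rfl⟩ ?_
    rintro _ ⟨τ, hτ, rfl⟩
    have hmem : τ ∈ Icc (S.φ₁ 0) T := ⟨(hS.delay₁.strictMonoOn.monotoneOn self_mem_Ici
      (show T ∈ Ici (0 : ℝ) from hT) hT).trans hτ.1, hτ.2⟩
    have h1 : ‖U τ‖ ≤ 2 * α * G * Real.exp (-μ * τ) :=
      (hexp _ _ _).1 ((le_csSup hPb (Or.inr ⟨τ, hmem, rfl⟩)).trans hle2)
    have h2 : Real.exp (-μ * τ) ≤ Real.exp (μ * R) * E := by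
      refine (exp_neg_mul_le_exp_neg_mul hμ0.le (hφT.trans hτ.1)).trans (le_of_eq ?_)
      rw [hE, ← Real.exp_add]
      ring_nf
    simp only
    gcongr
    exact h1.trans (by gcongr)
  rw [hEsq, ← hGsq, Γ]
  calc _ ≤ (2 * α * G * E) ^ 2 + (cO * G * E) ^ 2 +
        (2 * α * G * (Real.exp (μ * R) * E)) ^ 2 := by gcongr
    _ ≤ (2 * α * G * E) ^ 2 + (cO * G * E) ^ 2 +
        (2 * α * G * (Real.exp (μ * R) * E)) ^ 2 + (E * G) ^ 2 :=
        le_add_of_nonneg_right (sq_nonneg _)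
    _ = _ := by ring

end IsClosedLoop

/-- A constant rate `l` already works on all of `(0, ε*]`. The factor `1 - ε/(2ε*)`, at least `1/2`
there, is inserted only to make the rate strictly decreasing. -/
theorem Admissible.exists_isStabilityConstants (hS : S.Admissible) :
    ∃ (εs M : ℝ) (Cf : ℝ → ℝ),
      S.IsStabilityConstants εs M Cf ∧ StrictAntiOn Cf (Ioc 0 εs) := by
  obtain ⟨εs, hεs, l, hl, M, hM, hΓ⟩ := IsClosedLoop.exists_Γ_decay hS
  have hanti : StrictAnti fun ε => l * (1 - ε / (2 * εs)) := fun x y hxy =>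
    mul_lt_mul_of_pos_left (sub_lt_sub_left (by gcongr) _) hl
  refine ⟨εs, M, fun ε => l * (1 - ε / (2 * εs)), ⟨hεs, hM, fun ε hε => ?_,
    hanti.antitone.antitoneOn _, fun ε hε ψh hψ Z ξ U hloop t ht => ?_⟩, hanti.strictAntiOn _⟩
  · refine mul_pos hl (sub_pos.2 ?_)
    rw [div_lt_one (by positivity)]
    linarith [hε.1, hε.2]
  · refine (hΓ hloop (fun t ht => (hψ t ht).trans hε.2.le) t ht).trans ?_
    have := S.Γ_nonneg Z ξ U 0
    gcongr
    refine mul_le_of_le_one_right hl.le ?_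
    have : 0 ≤ ε / (2 * εs) := div_nonneg hε.1.le (by positivity)
    linarith

/-- A bound that holds with factor `M` at time `0` too may be weakened by `log M / H` in the rate,
whatever the sign of `log M`. -/
theorem IsStabilityConstants.bound_sub_log {εs M : ℝ} {Cf : ℝ → ℝ}
    (h : S.IsStabilityConstants εs M Cf) {ε : ℝ} (hε : ε ∈ Ioo 0 εs) {ψh : ℝ → ℝ}
    (hψ : ∀ t ≥ 0, |S.ψ t - ψh t| ≤ ε) {Z ξ : ℝ → Vec n} {U : ℝ → Vec m}
    (hloop : S.IsClosedLoop ψh Z ξ U) {H : ℝ} (hH : 0 < H) {t : ℝ} (ht : 0 ≤ t) :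
    S.Γ Z ξ U t ≤ M * Real.exp (-(Cf ε - Real.log M / H) * t) * S.Γ Z ξ U 0 := by
  have hb := h.bound ε hε ψh hψ Z ξ U hloop
  have hM := h.M_pos
  have hΓ := S.Γ_nonneg Z ξ U 0
  refine (hb t ht).trans ?_
  rcases le_or_gt 1 M with hM1 | hM1
  · have : 0 ≤ Real.log M / H := div_nonneg (Real.log_nonneg hM1) hH.le
    gcongr
    linarith
  -- For `M < 1` the bound at time `0` reads `Γ(0) ≤ M Γ(0)`, so `Γ(0) = 0` and the claim is
  -- trivial.
  · have h0 := hb 0 le_rfl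
    rw [mul_zero, Real.exp_zero, mul_one] at h0
    have : S.Γ Z ξ U 0 = 0 := by nlinarith
    simp [this]

/-- Transfers the accuracy on each window to the concatenated horizon `windowed`, for all
nonnegative times at once. -/
theorem mem_Icc_floor_window {H t : ℝ} (hH : 0 < H) (ht : 0 ≤ t) :
    t ∈ Icc (⌊t / H⌋₊ * H) (⌊t / H⌋₊ * H + H) := by
  have h1 : (⌊t / H⌋₊ : ℝ) ≤ t / H := Nat.floor_le (by positivity)
  have h2 : t / H < ⌊t / H⌋₊ + 1 := Nat.lt_floor_add_one _
  rw [le_div_iff₀ hH] at h1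
  rw [div_lt_iff₀ hH] at h2
  exact ⟨h1, by linarith⟩

end DelaySystem

end

theorem corollary1 {n m p : ℕ} (S : DelaySystem n m p) (hS : S.Admissible) :
    (∃ (εs M : ℝ) (Cf : ℝ → ℝ),
      S.IsStabilityConstants εs M Cf ∧ StrictAntiOn Cf (Set.Ioc 0 εs)) ∧
    ∀ (εs M : ℝ) (Cf : ℝ → ℝ), S.IsStabilityConstants εs M Cf →
      ∀ ε ∈ Set.Ioo 0 εs, ∀ H : ℝ, 0 < H → Real.log M / Cf εs < H →
        (∀ t ≥ 0, ∃ ψt : ℝ → ℝ, ContinuousOn ψt (Set.Icc t (t + H)) ∧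
          ∀ τ ∈ Set.Icc t (t + H), |S.ψ τ - ψt τ| ≤ ε) ∧
        0 < Cf ε - Real.log M / H ∧
        ∀ ψw : ℕ → ℝ → ℝ,
          (∀ k : ℕ, ∀ τ ∈ Set.Icc (k * H) (k * H + H), |S.ψ τ - ψw k τ| ≤ ε) →
          ∀ (Z ξ : ℝ → Vec n) (U : ℝ → Vec m),
            S.IsClosedLoop (DelaySystem.windowed H ψw) Z ξ U →
            ∀ t ≥ 0, S.Γ Z ξ U t ≤
              M * Real.exp (-(Cf ε - Real.log M / H) * t) * S.Γ Z ξ U 0 := by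
  refine ⟨hS.exists_isStabilityConstants, fun εs M Cf h ε hε H hH hlog => ⟨fun t ht => ?_, ?_, ?_⟩⟩
  -- The exact horizon is continuous and serves as its own approximation.
  · refine ⟨S.ψ, hS.continuousOn_ψ.mono fun x hx => ht.trans hx.1, fun τ _ => ?_⟩
    rw [sub_self, abs_zero]
    exact hε.1.le
  · have hCs := h.rate_pos εs ⟨h.eps_pos, le_rfl⟩
    -- The window condition involves `C(ε*)`; monotonicity gives `ln M < H C(ε*) ≤ H C(ε)`.
    have hanti := h.rate_anti ⟨hε.1, hε.2.le⟩ ⟨h.eps_pos, le_rfl⟩ hε.2.le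
    rw [div_lt_iff₀ hCs] at hlog
    rw [sub_pos, div_lt_iff₀ hH, mul_comm]
    exact hlog.trans_le (mul_le_mul_of_nonneg_left hanti hH.le)
  · intro ψw hψw Z ξ U hloop t ht
    exact h.bound_sub_log hε
      (fun τ hτ => hψw _ τ (DelaySystem.mem_Icc_floor_window hH hτ)) hloop hH ht
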